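/- Let $k$ be an algebraically closed field. A *$k$-scheme* is a separated scheme of finite type over $k$; a *fat point* is a finite $k$-scheme with exactly one point, and its *length* is the length of its coordinate ring. For a $k$-scheme $X$ let $X^\circ$ be the presheaf $\mathfrak w\mapsto X(\mathfrak w)=\mathrm{Mor}_k(\mathfrak w,X)$ on the category of fat points; a *sieve* on $X$ is a sub-presheaf of $X^\circ$. A sieve is *sub-Zariski* if it is the image of $Y^\circ\to X^\circ$ for some morphism of $k$-schemes $Y\to X$, and a sieve $\mathfrak M$ is a *formal motif* if for every fat point $\mathfrak w$ it contains a sub-Zariski sieve with the same $\mathfrak w$-rational points as $\mathfrak M$. A morphism of formal motives $\mathfrak M\to\mathfrak N$ (on $X$ and $Y$) is a natural transformation such that for every morphism of $k$-schemes $W\to X$ with image in $\mathfrak M$, the composite $W^\circ\to\mathfrak M\to\mathfrak N\subset Y^\circ$ is induced by a morphism of $k$-schemes $W\to Y$. Let $\mathrm{Gr}$ be the free abelian group on the formal motives modulo $[\emptyset]=0$, $[\mathfrak M]+[\mathfrak N]=[\mathfrak M\cup\mathfrak N]+[\mathfrak M\cap\mathfrak N]$ for $\mathfrak M,\mathfrak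 N$ on the same $k$-scheme, and $[\mathfrak M]=[\mathfrak N]$ for $\mathfrak M\cong\mathfrak N$, with multiplication $[\mathfrak M][\mathfrak N]=[\mathfrak M\times\mathfrak N]$. Let $\mathbb L=[(\mathbb A^1_k)^\circ]$ and $\mathbf G=\mathrm{Gr}_{\mathbb L}$ (the localization inverting $\mathbb L$). Let *split points* be the fat points with only the split epimorphisms as morphisms, and let a *split sieve* on $X$ be a subfunctor of the restriction of $X^\circ$ to split points. It is *split formal* if it is a Boolean combination of formal motives on $X$; it is then a finite disjoint union of differences $\mathfrak C_i-\mathfrak D_i$ with $\mathfrak D_i\subset\mathfrak C_i$ formal motives on $X$, and its class in $\mathbf G$ is $\sum_i([\mathfrak C_i]-[\mathfrak D_i])$. A *formal invariant* on $X$ is a natural transformation $s\colon\mathfrak X\to\underline{\mathbf G}$ from a split formal motif $\mathfrak X$ on $X$ to the constant presheaf with value $\mathbf G$, all of whose fibres $s^{-1}(g)\subset\mathfrak X$ ($g\in\mathbf G$) are split formal, only finitely many being non-empty. For $U\subset X$ open, $s|_U$ is the restriction of $s$ to $\mathfrak X\cap U^\circ$, a formal invariant on $U$. For a fat point $\mathfrak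 z$, the arc scheme $\nabla_{\mathfrak z}X$ is the $k$-scheme with $(\nabla_{\mathfrak z}X)(T)=X(\mathfrak z\times T)$ for all $k$-schemes $T$, and for a split sieve $\mathfrak F$ on $X$ the arc sieve $\nabla_{\mathfrak z}\mathfrak F$ on $\nabla_{\mathfrak z}X$ is given by $(\nabla_{\mathfrak z}\mathfrak F)(\mathfrak w)=\mathfrak F(\mathfrak z\times\mathfrak w)$. The *split motivic integral* of $s$ on $X$ along $\mathfrak z$ is $$\int_X s\,d_{\mathfrak z}:=\mathbb L^{-dl}\sum_{g\in\mathbf G}g\cdot[\nabla_{\mathfrak z}(s^{-1}(g))]\in\mathbf G,$$ the sum being over the finitely many $g$ with non-empty fibre, where $d=\dim X$ and $l$ is the length of $\mathfrak z$. **Theorem.** Let $X$ be a $k$-scheme that is equidimensional (every non-empty open subscheme has the same dimension as $X$), let $s\colon\mathfrak X\to\underline{\mathbf G}$ be a formal invariant on $X$, let $\mathfrak z$ be a fat point, and let $U_1,\dots,U_n$ be an open covering of $X$. For $\emptyset\ne I\subset\{1,\dots,n\}$ put $U_I=\bigcap_{i\in I}U_i$. Then the integrals $\int_X s\,d_{\mathfrak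 z}$ and $\int_{U_I}s|_{U_I}\,d_{\mathfrak z}$ are well-defined (the arc schemes exist, the arc sieves of the fibres have classes in $\mathbf G$, and the resulting value does not depend on the choices), and $$\int_X s\,d_{\mathfrak z}=\sum_{\emptyset\ne I\subset\{1,\dots,n\}}(-1)^{|I|+1}\int_{U_I}s|_{U_I}\,d_{\mathfrak z}.$$ -/

import Mathlib

open CategoryTheory Opposite Limits AlgebraicGeometry MonoidalCategory CartesianMonoidalCategory

universe u

attribute [local instance] Over.cartesianMonoidalCategory

noncomputable section

namespace FatMotive

/-! ### Schemes and fat points over a field -/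

/-- The base scheme `Spec k`. -/
abbrev Base (k : Type u) [Field k] : Scheme.{u} := Spec (CommRingCat.of k)

/-- A `k`-scheme in the sense used here: separated and of finite type over `Spec k`. -/
class IsAlgScheme {k : Type u} [Field k] (X : Over (Base k)) : Prop where
  isSeparated : IsSeparated X.hom
  locallyOfFiniteType : LocallyOfFiniteType X.hom
  quasiCompact : QuasiCompact X.hom

attribute [instance] IsAlgScheme.isSeparated IsAlgScheme.locallyOfFiniteType
  IsAlgScheme.quasiCompact

/-- Fat points over `k`: finite `k`-schemes with exactly one point. -/
def isFatPoint (k : Type u) [Field k] : ObjectProperty (Over (Base k)) := fun z =>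
  IsFinite z.hom ∧ Nonempty z.left ∧ Subsingleton z.left

/-- The category of fat points over `k` (all `k`-morphisms between them). -/
abbrev FatPoint (k : Type u) [Field k] := (isFatPoint k).FullSubcategory

/-- The length of a fat point: the length of its coordinate ring as a module over itself. -/
def FatPoint.length {k : Type u} [Field k] (z : FatPoint k) : ℕ :=
  (Module.length Γ(z.obj.left, ⊤) Γ(z.obj.left, ⊤)).toNat

/-- `𝔸¹` over `k`. -/
def affineLine (k : Type u) [Field k] : Over (Base k) :=
  Over.mk (AffineSpace (PUnit.{u + 1}) (Base k) ↘ Base k)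

/-- An open subscheme of a `k`-scheme, as a `k`-scheme. -/
def openSub {k : Type u} [Field k] (X : Over (Base k)) (U : X.left.Opens) : Over (Base k) :=
  Over.mk (U.ι ≫ X.hom)

/-- The inclusion of an open subscheme. -/
def openSub.ι {k : Type u} [Field k] (X : Over (Base k)) (U : X.left.Opens) : openSub X U ⟶ X :=
  Over.homMk U.ι rfl

section Instances

variable {k : Type u} [Field k]

instance isAlgScheme_tensor (X Y : Over (Base k)) [IsAlgScheme X] [IsAlgScheme Y] :
    IsAlgScheme (X ⊗ Y) where
  isSeparated := by rw [Over.tensorObj_hom]; infer_instance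
  locallyOfFiniteType := by rw [Over.tensorObj_hom]; infer_instance
  quasiCompact := by rw [Over.tensorObj_hom]; infer_instance

instance isAlgScheme_unit : IsAlgScheme (𝟙_ (Over (Base k))) where
  isSeparated := inferInstanceAs (IsSeparated (𝟙 (Base k)))
  locallyOfFiniteType := inferInstanceAs (LocallyOfFiniteType (𝟙 (Base k)))
  quasiCompact := inferInstanceAs (QuasiCompact (𝟙 (Base k)))

instance isAlgScheme_affineLine : IsAlgScheme (affineLine k) where
  isSeparated := by dsimp [affineLine]; infer_instance
  locallyOfFiniteType := by dsimp [affineLine]; infer_instance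
  quasiCompact := by dsimp [affineLine]; infer_instance

instance isAlgScheme_openSub (X : Over (Base k)) [IsAlgScheme X] (U : X.left.Opens) :
    IsAlgScheme (openSub X U) where
  isSeparated := by dsimp [openSub]; infer_instance
  locallyOfFiniteType := by dsimp [openSub]; infer_instance
  quasiCompact := by
    have : IsLocallyNoetherian X.left := LocallyOfFiniteType.isLocallyNoetherian X.hom
    dsimp [openSub]; infer_instance

theorem isFatPoint.isFinite_tensor {z w : Over (Base k)} (hz : isFatPoint k z)
    (hw : isFatPoint k w) : IsFinite (z ⊗ w).hom := by
  have := hz.1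
  have := hw.1
  rw [Over.tensorObj_hom]; infer_instance

theorem exists_section [IsAlgClosed k] {z : Over (Base k)} (hz : IsFinite z.hom) (x : z.left) :
    ∃ p : 𝟙_ (Over (Base k)) ⟶ z, p.left (IsLocalRing.closedPoint k) = x := by
  have : IsLocallyArtinian z.left := .of_locallyQuasiFinite z.hom
  have hx : IsClosed ({x} : Set z.left) := isClosed_discrete _
  exact ⟨Over.homMk (pointOfClosedPoint z.hom x hx) (by
      rw [pointOfClosedPoint_comp]; rfl), pointOfClosedPoint_apply z.hom x hx _⟩

theorem section_unique [IsAlgClosed k] {z : Over (Base k)} (hz : isFatPoint k z)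
    (p q : 𝟙_ (Over (Base k)) ⟶ z) : p = q := by
  have := hz.1
  have := hz.2.2
  ext
  exact ext_of_apply_closedPoint_eq z.hom (Over.w p) (Over.w q) (Subsingleton.elim _ _)

/-- Over an algebraically closed field, the product of two fat points is a fat point. -/
theorem isFatPoint_tensor [IsAlgClosed k] {z w : Over (Base k)} (hz : isFatPoint k z)
    (hw : isFatPoint k w) : isFatPoint k (z ⊗ w) := by
  refine ⟨hz.isFinite_tensor hw, ?_, ⟨fun x y => ?_⟩⟩
  · obtain ⟨p, -⟩ := exists_section hz.1 hz.2.1.some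
    obtain ⟨q, -⟩ := exists_section hw.1 hw.2.1.some
    exact ⟨(lift p q).left (IsLocalRing.closedPoint k)⟩
  · obtain ⟨p, rfl⟩ := exists_section (hz.isFinite_tensor hw) x
    obtain ⟨q, rfl⟩ := exists_section (hz.isFinite_tensor hw) y
    rw [CartesianMonoidalCategory.hom_ext p q (section_unique hz _ _) (section_unique hw _ _)]

end Instances

/-- The functor `w ↦ z × w` on fat points. -/
def prodLeft {k : Type u} [Field k] [IsAlgClosed k] (z : FatPoint k) : FatPoint k ⥤ FatPoint k :=
  (isFatPoint k).lift ((isFatPoint k).ι ⋙ tensorLeft z.obj)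
    (fun w => isFatPoint_tensor z.property w.property)

/-! ### Sieves and formal motives -/

section Sieves

variable {k : Type u} [Field k]

/-- The presheaf `X°` on fat points represented by `X`: `z ↦ X(z) = Mor_k(z, X)`. -/
def points (X : Over (Base k)) : (FatPoint k)ᵒᵖ ⥤ Type u :=
  (isFatPoint k).ι.op ⋙ yoneda.obj X

/-- The natural transformation `X° ⟶ Y°` induced by a morphism. -/
def pointsMap {X Y : Over (Base k)} (f : X ⟶ Y) : points X ⟶ points Y :=
  Functor.whiskerLeft _ (yoneda.map f)

/-- A sieve on `X`: a sub-presheaf of `X°`. -/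
abbrev MSieve (X : Over (Base k)) := Subfunctor (points X)

/-- Sub-Zariski sieves on `X`: the images of morphisms of `k`-schemes `Y ⟶ X`. -/
def IsSubZariski {X : Over (Base k)} (M : MSieve X) : Prop :=
  ∃ (Y : Over (Base k)) (_ : IsAlgScheme Y) (φ : Y ⟶ X), M = Subfunctor.range (pointsMap φ)

/-- Formal motives on `X`: sieves having, for each fat point `z`, a sub-Zariski approximation
with the same `z`-rational points. -/
def IsFormal {X : Over (Base k)} (M : MSieve X) : Prop :=
  ∀ z : FatPoint k, ∃ N : MSieve X, N ≤ M ∧ IsSubZariski N ∧ N.obj (op z) = M.obj (op z)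

theorem mem_range_pointsMap {X Y : Over (Base k)} (f : X ⟶ Y) (z : (FatPoint k)ᵒᵖ)
    (a : z.unop.obj ⟶ Y) :
    (show (points Y).obj z from a) ∈ (Subfunctor.range (pointsMap f)).obj z ↔
      ∃ b : z.unop.obj ⟶ X, b ≫ f = a := Iff.rfl

theorem IsSubZariski.isFormal {X : Over (Base k)} {M : MSieve X} (h : IsSubZariski M) :
    IsFormal M := fun _ => ⟨M, le_rfl, h, rfl⟩

theorem IsSubZariski.preimage {X Y : Over (Base k)} [IsAlgScheme X] [IsAlgScheme Y]
    (f : X ⟶ Y) {M : MSieve Y} (h : IsSubZariski M) :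
    IsSubZariski (M.preimage (pointsMap f)) := by
  obtain ⟨Z, hZ, φ, rfl⟩ := h
  have hφ : φ.left ≫ Y.hom = Z.hom := Over.w φ
  have : IsSeparated (φ.left ≫ Y.hom) := hφ ▸ hZ.isSeparated
  have : LocallyOfFiniteType (φ.left ≫ Y.hom) := hφ ▸ hZ.locallyOfFiniteType
  have : QuasiCompact (φ.left ≫ Y.hom) := hφ ▸ hZ.quasiCompact
  have : IsSeparated φ.left := .of_comp φ.left Y.hom
  have : LocallyOfFiniteType φ.left := locallyOfFiniteType_of_comp φ.left Y.hom
  have : QuasiCompact φ.left := .of_comp φ.left Y.hom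
  have hf : f.left ≫ Y.hom = X.hom := Over.w f
  let P : Over (Base k) := Over.mk (pullback.snd φ.left f.left ≫ X.hom)
  refine ⟨P, ⟨?_, ?_, ?_⟩, Over.homMk (pullback.snd φ.left f.left) rfl, ?_⟩
  · dsimp [P]; infer_instance
  · dsimp [P]; infer_instance
  · dsimp [P]; infer_instance
  · ext z a
    change z.unop.obj ⟶ X at a
    constructor
    · rintro ⟨b, hb⟩
      change z.unop.obj ⟶ Z at b
      have hb : b ≫ φ = a ≫ f := hb
      refine ⟨Over.homMk (pullback.lift b.left a.left ?_) ?_, ?_⟩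
      · rw [← Over.comp_left, ← Over.comp_left, hb]
      · exact (pullback.lift_snd_assoc _ _ _ _).trans (Over.w a)
      · change _ ≫ _ = a
        ext
        exact pullback.lift_snd _ _ _
    · rintro ⟨b, hb⟩
      change z.unop.obj ⟶ P at b
      have hb : b ≫ Over.homMk (pullback.snd φ.left f.left) rfl = a := hb
      refine ⟨b ≫ Over.homMk (pullback.fst φ.left f.left) ?_, ?_⟩
      · simp only [P, Over.mk_hom]
        rw [← hφ, ← hf, pullback.condition_assoc]
      · change (b ≫ _) ≫ φ = a ≫ f
        rw [← hb]
        ext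
        simp [pullback.condition]

theorem IsSubZariski.inf {X : Over (Base k)} [IsAlgScheme X] {M N : MSieve X}
    (hM : IsSubZariski M) (hN : IsSubZariski N) : IsSubZariski (M ⊓ N) := by
  obtain ⟨Z, hZ, φ, rfl⟩ := hN
  obtain ⟨W, hW, ψ, h⟩ := hM.preimage φ
  refine ⟨W, hW, ψ ≫ φ, ?_⟩
  ext z a
  change z.unop.obj ⟶ X at a
  constructor
  · rintro ⟨h1, b, hb⟩
    change z.unop.obj ⟶ Z at b
    have hb : b ≫ φ = a := hb
    subst hb
    have h1 : (show (points Z).obj z from b) ∈ (M.preimage (pointsMap φ)).obj z := h1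
    rw [h] at h1
    obtain ⟨c, hc⟩ := h1
    change z.unop.obj ⟶ W at c
    have hc : c ≫ ψ = b := hc
    exact ⟨c, by change c ≫ ψ ≫ φ = b ≫ φ; rw [← hc, Category.assoc]⟩
  · rintro ⟨c, hc⟩
    change z.unop.obj ⟶ W at c
    have hc : c ≫ ψ ≫ φ = a := hc
    subst hc
    have h1 : (show (points Z).obj z from c ≫ ψ) ∈ (M.preimage (pointsMap φ)).obj z := by
      rw [h]; exact ⟨c, rfl⟩
    refine ⟨?_, ⟨(c ≫ ψ : z.unop.obj ⟶ Z), by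
      change (c ≫ ψ) ≫ φ = c ≫ ψ ≫ φ; exact Category.assoc _ _ _⟩⟩
    have h1 : (show (points X).obj z from (c ≫ ψ) ≫ φ) ∈ M.obj z := h1
    rwa [Category.assoc] at h1

theorem lift_coprod {T Y Z : Scheme.{u}} [Nonempty T] [Subsingleton T] (b : T ⟶ Y ⨿ Z) :
    (∃ c : T ⟶ Y, c ≫ coprod.inl = b) ∨ ∃ c : T ⟶ Z, c ≫ coprod.inr = b := by
  obtain ⟨x⟩ := ‹Nonempty T›
  have hr : ∀ S : Set (Y ⨿ Z : Scheme.{u}), b x ∈ S → Set.range b ⊆ S := by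
    rintro S hS _ ⟨y, rfl⟩
    rwa [Subsingleton.elim y x]
  obtain ⟨y, hy⟩ := (coprodMk Y Z).surjective (b x)
  rcases y with y | y
  · rw [coprodMk_inl] at hy
    exact Or.inl ⟨_, IsOpenImmersion.lift_fac coprod.inl b (hr (Set.range _) ⟨y, hy⟩)⟩
  · rw [coprodMk_inr] at hy
    exact Or.inr ⟨_, IsOpenImmersion.lift_fac coprod.inr b (hr (Set.range _) ⟨y, hy⟩)⟩

theorem isAlgScheme_coprod {Y Z : Over (Base k)} (hY : IsAlgScheme Y) (hZ : IsAlgScheme Z) :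
    IsAlgScheme (Over.mk (coprod.desc Y.hom Z.hom)) where
  isSeparated := by
    have e : coprod.desc Y.hom Z.hom =
      coprod.map Y.hom Z.hom ≫ coprod.desc (𝟙 (Base k)) (𝟙 (Base k)) := by simp
    dsimp only [Over.mk_hom]
    rw [e]
    have : IsSeparated (coprod.map Y.hom Z.hom) :=
      IsZariskiLocalAtTarget.coprodMap (P := @IsSeparated.{u}) _ _ hY.1 hZ.1
    infer_instance
  locallyOfFiniteType := by
    have : IsZariskiLocalAtSource @LocallyOfFiniteType.{u} :=
      HasRingHomProperty.instIsZariskiLocalAtSource (P := @LocallyOfFiniteType.{u})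
    dsimp only [Over.mk_hom]
    rw [IsZariskiLocalAtSource.iff_of_openCover (P := @LocallyOfFiniteType.{u})
      (coprodOpenCover.{_, 0} Y.left Z.left)]
    rintro (x | x)
    · change LocallyOfFiniteType (coprod.inl ≫ coprod.desc Y.hom Z.hom)
      rw [coprod.inl_desc]
      exact hY.2
    · change LocallyOfFiniteType (coprod.inr ≫ coprod.desc Y.hom Z.hom)
      rw [coprod.inr_desc]
      exact hZ.2
  quasiCompact := by
    have : CompactSpace Y.left := (quasiCompact_iff_compactSpace Y.hom).1 hY.3
    have : CompactSpace Z.left := (quasiCompact_iff_compactSpace Z.hom).1 hZ.3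
    have : CompactSpace (Y.left ⨿ Z.left : Scheme.{u}) := (coprodMk Y.left Z.left).compactSpace
    exact (quasiCompact_iff_compactSpace (coprod.desc Y.hom Z.hom)).2 ‹_›

theorem IsSubZariski.sup {X : Over (Base k)} {M N : MSieve X}
    (hM : IsSubZariski M) (hN : IsSubZariski N) : IsSubZariski (M ⊔ N) := by
  obtain ⟨Y, hY, φ, rfl⟩ := hM
  obtain ⟨Z, hZ, ψ, rfl⟩ := hN
  let C : Over (Base k) := Over.mk (coprod.desc Y.hom Z.hom)
  let i : Y ⟶ C := Over.homMk coprod.inl (coprod.inl_desc _ _)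
  let j : Z ⟶ C := Over.homMk coprod.inr (coprod.inr_desc _ _)
  let Φ : C ⟶ X := Over.homMk (coprod.desc φ.left ψ.left) (coprod.hom_ext
    (by simp [C]) (by simp [C]))
  have hi : i ≫ Φ = φ := by ext; exact coprod.inl_desc _ _
  have hj : j ≫ Φ = ψ := by ext; exact coprod.inr_desc _ _
  refine ⟨C, isAlgScheme_coprod hY hZ, Φ, ?_⟩
  ext z a
  change z.unop.obj ⟶ X at a
  have := z.unop.property.2.1
  have := z.unop.property.2.2
  constructor
  · rintro (⟨b, hb⟩ | ⟨b, hb⟩)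
    · change z.unop.obj ⟶ Y at b
      have hb : b ≫ φ = a := hb
      exact ⟨b ≫ i, by change (b ≫ i) ≫ Φ = a; rw [Category.assoc, hi, hb]⟩
    · change z.unop.obj ⟶ Z at b
      have hb : b ≫ ψ = a := hb
      exact ⟨b ≫ j, by change (b ≫ j) ≫ Φ = a; rw [Category.assoc, hj, hb]⟩
  · rintro ⟨b, hb⟩
    change z.unop.obj ⟶ C at b
    have hb : b ≫ Φ = a := hb
    have hw : b.left ≫ coprod.desc Y.hom Z.hom = z.unop.obj.hom := Over.w b
    rcases lift_coprod b.left with ⟨c, hc⟩ | ⟨c, hc⟩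
    · have h1 : c ≫ Y.hom = z.unop.obj.hom := by
        rw [← hw, ← hc, Category.assoc, coprod.inl_desc]
      have h2 : Over.homMk c h1 ≫ i = b := by ext; exact hc
      refine Or.inl ⟨Over.homMk c h1, ?_⟩
      change Over.homMk c h1 ≫ φ = a
      rw [← hi, ← Category.assoc, h2, hb]
    · have h1 : c ≫ Z.hom = z.unop.obj.hom := by
        rw [← hw, ← hc, Category.assoc, coprod.inr_desc]
      have h2 : Over.homMk c h1 ≫ j = b := by ext; exact hc
      refine Or.inr ⟨Over.homMk c h1, ?_⟩
      change Over.homMk c h1 ≫ ψ = a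
      rw [← hj, ← Category.assoc, h2, hb]

theorem isSubZariski_top {X : Over (Base k)} [IsAlgScheme X] :
    IsSubZariski (⊤ : MSieve X) := ⟨X, inferInstance, 𝟙 X, by
  ext z a
  exact ⟨fun _ => ⟨a, Category.comp_id (show z.unop.obj ⟶ X from a)⟩, fun _ => trivial⟩⟩

theorem isSubZariski_bot {X : Over (Base k)} : IsSubZariski (⊥ : MSieve X) := by
  refine ⟨Over.mk (initial.to (Base k)), ⟨?_, ?_, ?_⟩,
    Over.homMk (initial.to X.left) (initialIsInitial.hom_ext _ _), ?_⟩
  · dsimp only [Over.mk_hom]; infer_instance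
  · exact locallyOfFiniteType_of_isOpenImmersion (initial.to (Base k))
  · exact inferInstanceAs (QuasiCompact (initial.to (Base k)))
  · ext z a
    refine ⟨fun h => h.elim, ?_⟩
    rintro ⟨b, -⟩
    change z.unop.obj ⟶ Over.mk (initial.to (Base k)) at b
    exact (IsEmpty.false (α := (⊥_ Scheme.{u} : Scheme.{u})) (b.left z.unop.property.2.1.some)).elim

theorem isFormal_top {X : Over (Base k)} [IsAlgScheme X] : IsFormal (⊤ : MSieve X) :=
  isSubZariski_top.isFormal

theorem isFormal_bot {X : Over (Base k)} : IsFormal (⊥ : MSieve X) :=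
  isSubZariski_bot.isFormal

theorem IsFormal.preimage {X Y : Over (Base k)} [IsAlgScheme X] [IsAlgScheme Y]
    (f : X ⟶ Y) {M : MSieve Y} (h : IsFormal M) : IsFormal (M.preimage (pointsMap f)) := by
  intro z
  obtain ⟨N, hle, hN, hz⟩ := h z
  exact ⟨N.preimage (pointsMap f), fun w a ha => hle w ha, hN.preimage f,
    by ext a; exact Set.ext_iff.1 hz _⟩

theorem IsFormal.inf {X : Over (Base k)} [IsAlgScheme X] {M N : MSieve X}
    (hM : IsFormal M) (hN : IsFormal N) : IsFormal (M ⊓ N) := by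
  intro z
  obtain ⟨M', hM1, hM2, hM3⟩ := hM z
  obtain ⟨N', hN1, hN2, hN3⟩ := hN z
  exact ⟨M' ⊓ N', inf_le_inf hM1 hN1, hM2.inf hN2, by simp [hM3, hN3]⟩

theorem IsFormal.sup {X : Over (Base k)} {M N : MSieve X}
    (hM : IsFormal M) (hN : IsFormal N) : IsFormal (M ⊔ N) := by
  intro z
  obtain ⟨M', hM1, hM2, hM3⟩ := hM z
  obtain ⟨N', hN1, hN2, hN3⟩ := hN z
  exact ⟨M' ⊔ N', sup_le_sup hM1 hN1, hM2.sup hN2, by simp [hM3, hN3]⟩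

end Sieves

/-! ### The Grothendieck ring of formal motives -/

/-- A formal motif over `k`: a formal sieve on some `k`-scheme. -/
structure Motif (k : Type u) [Field k] where
  /-- the ambient scheme -/
  space : Over (Base k)
  isAlg : IsAlgScheme space
  /-- the sieve -/
  sieve : MSieve space
  formal : IsFormal sieve

section Grot

variable {k : Type u} [Field k]

/-- A formal sieve on a given `k`-scheme, as a formal motif. -/
def Motif.mk' (X : Over (Base k)) [IsAlgScheme X] (M : MSieve X) (h : IsFormal M) : Motif k :=
  ⟨X, inferInstance, M, h⟩

/-- The product of two formal motives: `(M × N)(z) = M(z) × N(z)` inside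
`(X × Y)(z) = X(z) × Y(z)`. -/
def Motif.prod (M N : Motif k) : Motif k :=
  have := M.isAlg
  have := N.isAlg
  .mk' (M.space ⊗ N.space)
    (M.sieve.preimage (pointsMap (fst M.space N.space)) ⊓
      N.sieve.preimage (pointsMap (snd M.space N.space)))
    ((M.formal.preimage _).inf (N.formal.preimage _))

/-- The motif of all points of a `k`-scheme. -/
def Motif.ofScheme (X : Over (Base k)) [IsAlgScheme X] : Motif k := .mk' X ⊤ isFormal_top

/-- Morphisms of formal motives: the natural transformations `s : M ⟶ N` of presheaves on fat points
such that every morphism `φ : W ⟶ X` from a `k`-scheme whose image lies in `M` is sent to a morphism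
of schemes, i.e. `W° ⟶ M ⟶ N ⊆ Y°` is induced by a morphism `W ⟶ Y`. (As presheaves on fat
points, schemes are disjoint unions of formal germs at their closed points; a bare natural
transformation may permute these germs arbitrarily.) -/
def IsMotivicHom {X Y : Over (Base k)} {M : MSieve X} {N : MSieve Y}
    (s : M.toFunctor ⟶ N.toFunctor) : Prop :=
  ∀ (W : Over (Base k)) [IsAlgScheme W] (φ : W ⟶ X) (h : Subfunctor.range (pointsMap φ) ≤ M),
    ∃ ψ : W ⟶ Y, Subfunctor.lift (pointsMap φ) h ≫ s ≫ N.ι = pointsMap ψ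

/-- The defining relations of the Grothendieck ring: the class of the empty motif is zero, the
scissor relations, isomorphic motives have the same class, multiplication is given by the product of motives, and `Spec k` is the unit.
As the product of two motives is again a motif, the quotient of the free commutative ring by these
relations is the free abelian group on the motives modulo the empty, scissor and isomorphism
relations, with the multiplication induced by the product of motives. -/
inductive GrotRel (k : Type u) [Field k] : FreeCommRing (Motif k) → FreeCommRing (Motif k) → Prop
  | empty (X : Over (Base k)) [IsAlgScheme X] : GrotRel k (.of (.mk' X ⊥ isFormal_bot)) 0
  | scissor (X : Over (Base k)) [IsAlgScheme X] (M N : MSieve X) (hM : IsFormal M)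
      (hN : IsFormal N) : GrotRel k (.of (.mk' X M hM) + .of (.mk' X N hN))
        (.of (.mk' X (M ⊔ N) (hM.sup hN)) + .of (.mk' X (M ⊓ N) (hM.inf hN)))
  | iso (M N : Motif k) (e : M.sieve.toFunctor ≅ N.sieve.toFunctor) (h : IsMotivicHom e.hom)
      (h' : IsMotivicHom e.inv) : GrotRel k (.of M) (.of N)
  | prod (M N : Motif k) : GrotRel k (.of M * .of N) (.of (M.prod N))
  | one : GrotRel k (.of (.ofScheme (𝟙_ (Over (Base k))))) 1

end Grot

/-- The Grothendieck ring of formal motives over `k`. -/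
abbrev Grot (k : Type u) [Field k] : Type (u + 1) := FreeCommRing (Motif k) ⧸ Ideal.ofRel (GrotRel k)

/-- The class of a formal motif. -/
def Motif.class {k : Type u} [Field k] (M : Motif k) : Grot k :=
  Ideal.Quotient.mk _ (FreeCommRing.of M)

/-- The Lefschetz class: the class of `𝔸¹`. -/
def lefschetz (k : Type u) [Field k] : Grot k := (Motif.ofScheme (affineLine k)).class

/-- The Grothendieck ring of formal motives, localized at the Lefschetz class. -/
abbrev LocGrot (k : Type u) [Field k] : Type (u + 1) := Localization.Away (lefschetz k)

/-- The class of a formal sieve in the localized Grothendieck ring. -/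
def formalClass {k : Type u} [Field k] {X : Over (Base k)} [IsAlgScheme X] (M : MSieve X)
    (h : IsFormal M) : LocGrot k :=
  algebraMap (Grot k) (LocGrot k) (Motif.mk' X M h).class

/-! ### Split points and split formal motives -/

/-- The split epimorphisms. -/
def splitEpis (C : Type*) [Category* C] : MorphismProperty C := fun _ _ f => IsSplitEpi f

instance splitEpis_isMultiplicative (C : Type*) [Category* C] : (splitEpis C).IsMultiplicative where
  id_mem X := (inferInstance : IsSplitEpi (𝟙 X))
  comp_mem f g hf hg := by
    obtain ⟨⟨s, hs⟩⟩ := hf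
    obtain ⟨⟨t, ht⟩⟩ := hg
    exact ⟨⟨t ≫ s, by simp [reassoc_of% hs, ht]⟩⟩

/-- The category of split points: fat points with split epimorphisms as morphisms. -/
abbrev SplitPoint (k : Type u) [Field k] := WideSubcategory (splitEpis (FatPoint k))

section Split

variable {k : Type u} [Field k]

/-- The restriction of a presheaf on fat points to the split points. -/
abbrev splitRes (F : (FatPoint k)ᵒᵖ ⥤ Type u) : (SplitPoint k)ᵒᵖ ⥤ Type u :=
  (wideSubcategoryInclusion (splitEpis (FatPoint k))).op ⋙ F

/-- A split sieve on `X`: a subfunctor of the restriction of `X°` to the split points. -/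
abbrev SplitSieve (X : Over (Base k)) := Subfunctor (splitRes (points X))

/-- The restriction of a sieve to the split points. -/
def MSieve.toSplit {X : Over (Base k)} (M : MSieve X) : SplitSieve X where
  obj w := M.obj (op w.unop.obj)
  map i := M.map ((wideSubcategoryInclusion (splitEpis (FatPoint k))).op.map i)

/-- Split formal motives: the Boolean combinations of formal motives, taken pointwise in the sets
`X(w)`. -/
def IsSplitFormal {X : Over (Base k)} (F : SplitSieve X) : Prop :=
  F.obj ∈ BooleanSubalgebra.closure {B | ∃ C : MSieve X, IsFormal C ∧ B = (MSieve.toSplit C).obj}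

/-- `HasClass F v`: the split sieve `F` is a disjoint union of finitely many differences
`C i - D i`, with `D i ⊆ C i` formal motives, and `v = ∑ i, ([C i] - [D i])`. For a split formal
motif `F`, this determines the class `v` of `F`. -/
def HasClass {X : Over (Base k)} [IsAlgScheme X] (F : SplitSieve X) (v : LocGrot k) : Prop :=
  ∃ (n : ℕ) (C D : Fin n → MSieve X) (hC : ∀ i, IsFormal (C i)) (hD : ∀ i, IsFormal (D i)),
    (∀ i, D i ≤ C i) ∧
    (∀ w, F.obj w = ⋃ i, (MSieve.toSplit (C i)).obj w \ (MSieve.toSplit (D i)).obj w) ∧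
    (∀ w, Pairwise (Function.onFun Disjoint
      fun i => (MSieve.toSplit (C i)).obj w \ (MSieve.toSplit (D i)).obj w)) ∧
    v = ∑ i, (formalClass (C i) (hC i) - formalClass (D i) (hD i))

/-- Inverse image of a split sieve under a morphism of schemes. -/
abbrev SplitSieve.pullback {X Y : Over (Base k)} (f : X ⟶ Y) (F : SplitSieve Y) : SplitSieve X :=
  F.preimage (Functor.whiskerLeft _ (pointsMap f))

theorem IsSplitFormal.pullback {X Y : Over (Base k)} [IsAlgScheme X] [IsAlgScheme Y] (f : X ⟶ Y)
    {F : SplitSieve Y} (h : IsSplitFormal F) : IsSplitFormal (F.pullback f) := by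
  let φ : BoundedLatticeHom (∀ w, Set ((splitRes (points Y)).obj w))
      (∀ w, Set ((splitRes (points X)).obj w)) :=
    { toFun := fun B w => (Functor.whiskerLeft _ (pointsMap f)).app w ⁻¹' B w
      map_sup' := fun _ _ => rfl
      map_inf' := fun _ _ => rfl
      map_top' := rfl
      map_bot' := rfl }
  have key : BooleanSubalgebra.closure
        {B | ∃ C : MSieve Y, IsFormal C ∧ B = (MSieve.toSplit C).obj} ≤
      (BooleanSubalgebra.closure
        {B | ∃ C : MSieve X, IsFormal C ∧ B = (MSieve.toSplit C).obj}).comap φ := by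
    rw [BooleanSubalgebra.closure_le]
    rintro _ ⟨C, hC, rfl⟩
    exact BooleanSubalgebra.subset_closure ⟨C.preimage (pointsMap f), hC.preimage f, rfl⟩
  exact key h

/-- The fibre at `g` of a natural transformation `s` from a split sieve to the constant presheaf
with value `G`. -/
def fibreOf {X : Over (Base k)} {G : Type*} (M : SplitSieve X) (s : ∀ w, M.obj w → G)
    (hs : ∀ {v w : (SplitPoint k)ᵒᵖ} (i : v ⟶ w) (a : M.obj v),
      s w ⟨(splitRes (points X)).map i a.1, M.map i a.2⟩ = s v a) (g : G) : SplitSieve X where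
  obj w := {a | ∃ h : a ∈ M.obj w, s w ⟨a, h⟩ = g}
  map i := fun _ ⟨h, e⟩ => ⟨M.map i h, (hs i ⟨_, h⟩).trans e⟩

/-- A formal invariant on `X`: a natural transformation from a split formal motif `M` on `X` to the
constant presheaf with value the localized Grothendieck ring, all of whose fibres are split formal
and only finitely many of whose fibres are non-empty. -/
structure FormalInvariant {X : Over (Base k)} (M : SplitSieve X) where
  splitFormal : IsSplitFormal M
  /-- the value at a `w`-rational point of `M` -/
  val : ∀ w, M.obj w → LocGrot k
  naturality : ∀ {v w : (SplitPoint k)ᵒᵖ} (i : v ⟶ w) (a : M.obj v),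
    val w ⟨(splitRes (points X)).map i a.1, M.map i a.2⟩ = val v a
  fibre_splitFormal : ∀ g, IsSplitFormal (fibreOf M val naturality g)
  finite_fibres : {g | ∃ w, ((fibreOf M val naturality g).obj w).Nonempty}.Finite

/-- The fibre of a formal invariant. -/
def FormalInvariant.fibre {X : Over (Base k)} {M : SplitSieve X} (s : FormalInvariant M)
    (g : LocGrot k) : SplitSieve X := fibreOf M s.val s.naturality g

/-- The restriction `s|_U` of a formal invariant `s` on `M` to `M ∩ U°`, viewed on the open
subscheme `U`. -/
def FormalInvariant.restrict {X : Over (Base k)} [IsAlgScheme X] {M : SplitSieve X}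
    (s : FormalInvariant M) (U : X.left.Opens) :
    FormalInvariant (M.pullback (openSub.ι X U)) where
  splitFormal := s.splitFormal.pullback _
  val w a := s.val w ⟨(Functor.whiskerLeft _ (pointsMap (openSub.ι X U))).app w a.1, a.2⟩
  naturality {v w} i a := by
    rw [← s.naturality i]
    congr 2
  fibre_splitFormal g := (s.fibre_splitFormal g).pullback (openSub.ι X U)
  finite_fibres := s.finite_fibres.subset fun _ ⟨w, a, h⟩ => ⟨w, _, h⟩

end Split

/-! ### Arcs -/

section Arcs

variable {k : Type u} [Field k] [IsAlgClosed k]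

/-- The functor `w ↦ z × w` on split points. -/
def splitProdLeft (z : FatPoint k) : SplitPoint k ⥤ SplitPoint k where
  obj w := ⟨(prodLeft z).obj w.obj⟩
  map f := ⟨(prodLeft z).map f.hom,
    have : IsSplitEpi f.hom := f.property
    (inferInstance : IsSplitEpi ((prodLeft z).map f.hom))⟩
  map_id _ := WideSubcategory.hom_ext _ ((prodLeft z).map_id _)
  map_comp _ _ := WideSubcategory.hom_ext _ ((prodLeft z).map_comp _ _)

/-- An arc scheme of `X` along the fat point `z`: a `k`-scheme `∇_z X` with a morphism
`z × ∇_z X ⟶ X` inducing bijections `(∇_z X)(T) ≅ X(z × T)` for all `k`-schemes `T` (the Weil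
restriction along `z ⟶ Spec k` of the base change of `X` to `z`). -/
structure ArcScheme (z : FatPoint k) (X : Over (Base k)) where
  /-- the arc scheme -/
  space : Over (Base k)
  isAlg : IsAlgScheme space
  /-- the universal arc -/
  ev : z.obj ⊗ space ⟶ X
  bijective : ∀ (T : Over (Base k)) [IsAlgScheme T],
    Function.Bijective (fun a : T ⟶ space => (z.obj ◁ a) ≫ ev)

attribute [instance] ArcScheme.isAlg

/-- The `z × w`-rational point of `X` corresponding to a `w`-rational point of the arc scheme. -/
def ArcScheme.toPoint {z : FatPoint k} {X : Over (Base k)} (A : ArcScheme z X)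
    (w : (SplitPoint k)ᵒᵖ) (a : (splitRes (points A.space)).obj w) :
    (splitRes (points X)).obj ((splitProdLeft z).op.obj w) :=
  (z.obj ◁ (show w.unop.obj.obj ⟶ A.space from a)) ≫ A.ev

/-- The arc sieve of a split sieve: `(∇_z F)(w) = F(z × w)`. -/
def ArcScheme.arc {z : FatPoint k} {X : Over (Base k)} (A : ArcScheme z X) (F : SplitSieve X) :
    SplitSieve A.space where
  obj w := {a | A.toPoint w a ∈ F.obj ((splitProdLeft z).op.obj w)}
  map {v w} i a ha := by
    have h := F.map ((splitProdLeft z).op.map i) ha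
    have e : A.toPoint w ((splitRes (points A.space)).map i a) =
        (splitRes (points X)).map ((splitProdLeft z).op.map i) (A.toPoint v a) := by
      change (z.obj ◁ (i.unop.hom.hom ≫ (show v.unop.obj.obj ⟶ A.space from a))) ≫ A.ev =
        (z.obj ◁ i.unop.hom.hom) ≫ (z.obj ◁ (show v.unop.obj.obj ⟶ A.space from a)) ≫ A.ev
      exact (congrArg (· ≫ A.ev) (whiskerLeft_comp _ _ _)).trans (Category.assoc _ _ _)
    exact (congrArg (· ∈ F.obj ((splitProdLeft z).op.obj w)) e).mpr h

end Arcs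

/-! ### Motivic integrals -/

/-- The dimension of a scheme, as a natural number. It is used for schemes of finite type over a
field, which have finite dimension; the empty scheme is given dimension zero. -/
def dim (X : Scheme.{u}) : ℕ := ((topologicalKrullDim X).unbotD 0).toNat

/-- A scheme is equidimensional if all its non-empty opens have the same dimension as the scheme. -/
def IsEquidimensional (X : Scheme.{u}) : Prop :=
  ∀ U : X.Opens, (U : Set X).Nonempty → topologicalKrullDim U = topologicalKrullDim X

section Integral

variable {k : Type u} [Field k] [IsAlgClosed k]

/-- `IsMotivicIntegral z s v`: one has `v = 𝕃^{-dl} ∑_g g ⬝ [∇_z (s⁻¹ g)]`, where `d` is the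
dimension of `X` and `l` the length of `z`, and where the sum is over the finitely many `g` with
non-empty fibre. -/
def IsMotivicIntegral {X : Over (Base k)} {M : SplitSieve X} (z : FatPoint k)
    (s : FormalInvariant M) (v : LocGrot k) : Prop :=
  ∃ (A : ArcScheme z X) (c : LocGrot k → LocGrot k), (∀ g, HasClass (A.arc (s.fibre g)) (c g)) ∧
    v = IsLocalization.Away.invSelf (lefschetz k) ^ (dim X.left * z.length) *
      ∑ g ∈ s.finite_fibres.toFinset, g * c g

open Classical in
/-- The split motivic integral `∫_X s d_z` of a formal invariant along a fat point: the unique `v`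
with `IsMotivicIntegral z s v`. -/
def motivicIntegral {X : Over (Base k)} {M : SplitSieve X} (z : FatPoint k)
    (s : FormalInvariant M) : LocGrot k :=
  if h : ∃ v, IsMotivicIntegral z s v then h.choose else 0

end Integral

end FatMotive

end

open FatMotive

namespace FatMotive

/-! ### Weil restriction of finitely generated algebras -/

section WeilAlgebra

open scoped TensorProduct

/-! Fix a fibre `F` of the invariant. Over an algebraically closed field `z × w` is again a fat
point, so an arc `z × w ⟶ X` hits exactly one point `x` of `X` and factors through an open `U` if
and only if `x ∈ U` (`ArcScheme.mem_range_openSub`). Hence an arc lies in the intersection `U_I`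
exactly when `I ⊆ S`, where `S` is the set of indices `i` with `x ∈ U_i`. As the opens cover `X`,
`S` is non-empty, so the signs `(-1)^|I|` over `I ⊆ S` cancel. This is a linear relation between the
indicator functions of the split sieves `∇F ∩ ∇U_I` on the arc scheme `∇X`.

Two facts turn it into a relation between classes. The class is a valuation on the lattice of formal
sieves, so it respects every linear relation between indicator functions
(`sum_smul_eq_zero_of_hasClass`); uniqueness of classes is a special case. Moreover `∇U_I ⟶ ∇X`
identifies the arc sieve of the restriction of `F` to `U_I` with `∇F ∩ ∇U_I`, not only as presheaves
but as motives (`ArcScheme.isPointwiseEmbedding_openSub`, `HasClass.of_pullback`).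
Equidimensionality gives all integrals over non-empty `U_I` the same power of the Lefschetz class,
and the integral is linear in the classes of the fibres.

For well-definedness, arc schemes are built by Weil restriction over affine opens and glued
(`exists_isArc`). Gluing works because `z` has a single point, so that the arcs in an open `V` are
the inverse image of `V` under the projection to `X` (`IsArc.isPullback`). Arc sieves of formal
sieves are formal (`IsFormal.arcSieve`), and every Boolean combination of formal sieves is a finite
disjoint union of differences (`IsSplitFormal.hasDecomposition`). -/

/-- The coordinate of an element of `R ⊗ B` with respect to a basis element of `R`. -/
noncomputable def tensorCoord {k R ι : Type*} [Field k] [CommRing R] [Algebra k R]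
    (b : Module.Basis ι k R) (B : Type*) [CommRing B] [Algebra k B] (j : ι) : R ⊗[k] B →ₗ[k] B :=
  (TensorProduct.lid k B).toLinearMap ∘ₗ (b.coord j).rTensor B

variable {k R ι : Type*} [Field k] [CommRing R] [Algebra k R] (b : Module.Basis ι k R)
  {B C : Type*} [CommRing B] [Algebra k B] [CommRing C] [Algebra k C]

theorem tensorCoord_tmul (j : ι) (r : R) (x : B) :
    tensorCoord b B j (r ⊗ₜ x) = b.coord j r • x := by
  simp [tensorCoord]

theorem tensorCoord_map (h : B →ₐ[k] C) (j : ι) (t : R ⊗[k] B) :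
    tensorCoord b C j (Algebra.TensorProduct.map (AlgHom.id k R) h t) =
      h (tensorCoord b B j t) := by
  induction t with
  | zero => simp
  | tmul r x => simp [tensorCoord_tmul]
  | add x y hx hy => simp [hx, hy]

theorem sum_tensorCoord [Fintype ι] (t : R ⊗[k] B) :
    ∑ j, b j ⊗ₜ[k] tensorCoord b B j t = t := by
  induction t with
  | zero => simp
  | tmul r x =>
    simp only [tensorCoord_tmul, ← TensorProduct.smul_tmul]
    rw [← TensorProduct.sum_tmul]
    congr 1
    exact b.sum_repr r
  | add x y hx hy =>
    simp only [map_add, TensorProduct.tmul_add, Finset.sum_add_distrib, hx, hy]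

theorem tensorCoord_sum [Fintype ι] (c : ι → B) (j : ι) :
    tensorCoord b B j (∑ i, b i ⊗ₜ[k] c i) = c j := by
  classical
  simp [tensorCoord_tmul, Finsupp.single_apply, ite_smul]

theorem tensorCoord_ext [Fintype ι] {s t : R ⊗[k] B}
    (h : ∀ j, tensorCoord b B j s = tensorCoord b B j t) : s = t := by
  rw [← sum_tensorCoord b s, ← sum_tensorCoord b t]
  simp [h]

end WeilAlgebra

open scoped TensorProduct in
/-- The Weil restriction of a finitely generated algebra along a finite algebra over a field. -/
theorem exists_weilRestriction_algebra (k R A : Type u) [Field k] [CommRing R] [Algebra k R]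
    [Module.Finite k R] [CommRing A] [Algebra k A] [Algebra.FiniteType k A] :
    ∃ (W : Type u) (_ : CommRing W) (_ : Algebra k W) (_ : Algebra.FiniteType k W)
      (e : A →ₐ[k] R ⊗[k] W), ∀ (B : Type u) [CommRing B] [Algebra k B] (f : A →ₐ[k] R ⊗[k] B),
        ∃! h : W →ₐ[k] B, (Algebra.TensorProduct.map (AlgHom.id k R) h).comp e = f := by
  obtain ⟨n, π, hπ⟩ := Algebra.FiniteType.iff_quotient_mvPolynomial''.1
    (inferInstance : Algebra.FiniteType k A)
  let b := Module.finBasis k R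
  -- One variable for each coordinate of the image of each generator of `A`: `θ` sends the
  -- generators to generic elements, and `J` consists of the conditions, coordinate by coordinate,
  -- that the relations of `A` are respected.
  let Q := MvPolynomial (Fin n × Fin (Module.finrank k R)) k
  let θ : MvPolynomial (Fin n) k →ₐ[k] R ⊗[k] Q :=
    MvPolynomial.aeval fun i => ∑ j, b j ⊗ₜ[k] (MvPolynomial.X (i, j) : Q)
  let J : Ideal Q := Ideal.span {q | ∃ f j, π f = 0 ∧ q = tensorCoord b Q j (θ f)}
  let Θ := (Algebra.TensorProduct.map (AlgHom.id k R) (Ideal.Quotient.mkₐ k J)).comp θ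
  have hΘ : ∀ f, π f = 0 → Θ f = 0 := by
    intro f hf
    apply tensorCoord_ext b
    intro j
    rw [map_zero]
    refine (tensorCoord_map b (Ideal.Quotient.mkₐ k J) j (θ f)).trans ?_
    exact Ideal.Quotient.eq_zero_iff_mem.2 (Ideal.subset_span ⟨f, j, hf, rfl⟩)
  let e : A →ₐ[k] R ⊗[k] (Q ⧸ J) :=
    (Ideal.Quotient.liftₐ (RingHom.ker π) Θ hΘ).comp
      (Ideal.quotientKerAlgEquivOfSurjective hπ).symm.toAlgHom
  have he : e.comp π = Θ := by
    ext1 i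
    have : (Ideal.quotientKerAlgEquivOfSurjective hπ).symm (π (MvPolynomial.X i)) =
        Ideal.Quotient.mk _ (MvPolynomial.X i) := by
      rw [AlgEquiv.symm_apply_eq]; rfl
    change Ideal.Quotient.liftₐ (RingHom.ker π) Θ hΘ
      ((Ideal.quotientKerAlgEquivOfSurjective hπ).symm (π (MvPolynomial.X i))) = _
    rw [this]; rfl
  refine ⟨Q ⧸ J, inferInstance, inferInstance, inferInstance, e, fun B _ _ f => ?_⟩
  have hX : ∀ i j, tensorCoord b _ j (Θ (MvPolynomial.X i)) =
      Ideal.Quotient.mkₐ k J (MvPolynomial.X (i, j)) := by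
    intro i j
    refine (tensorCoord_map b (Ideal.Quotient.mkₐ k J) j (θ _)).trans ?_
    congr 1
    simp only [θ, MvPolynomial.aeval_X]
    exact tensorCoord_sum b _ j
  -- The only possible choice: the variables must go to the coordinates of the images of the
  -- generators under `f`.
  let h₀ : Q →ₐ[k] B := MvPolynomial.aeval fun p => tensorCoord b B p.2 (f (π (MvPolynomial.X p.1)))
  have hX₀ : ∀ p, h₀ (MvPolynomial.X p) = tensorCoord b B p.2 (f (π (MvPolynomial.X p.1))) :=
    fun p => MvPolynomial.aeval_X _ _
  have hh₀ : (Algebra.TensorProduct.map (AlgHom.id k R) h₀).comp θ = f.comp π := by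
    ext1 i
    simp only [AlgHom.comp_apply, θ, MvPolynomial.aeval_X, map_sum]
    refine Eq.trans ?_ (sum_tensorCoord b (f (π (MvPolynomial.X i))))
    refine Finset.sum_congr rfl fun j _ => ?_
    rw [Algebra.TensorProduct.map_tmul]
    rw [hX₀]; rfl
  have hJ : ∀ q ∈ J, h₀ q = 0 := by
    intro q hq
    have : J ≤ RingHom.ker h₀ := by
      rw [Ideal.span_le]
      rintro _ ⟨g, j, hg, rfl⟩
      change h₀ _ = 0
      rw [← tensorCoord_map, ← AlgHom.comp_apply, hh₀, AlgHom.comp_apply, hg, map_zero, map_zero]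
    exact this hq
  have hcomp : ∀ h : (Q ⧸ J) →ₐ[k] B, (Algebra.TensorProduct.map (AlgHom.id k R) h).comp Θ =
      (Algebra.TensorProduct.map (AlgHom.id k R) (h.comp (Ideal.Quotient.mkₐ k J))).comp θ := by
    intro h
    rw [← AlgHom.comp_assoc, ← Algebra.TensorProduct.map_id_comp]
  refine ⟨Ideal.Quotient.liftₐ J h₀ hJ, ?_, ?_⟩
  · change AlgHom.comp _ _ = _
    rw [← AlgHom.cancel_right hπ, AlgHom.comp_assoc, he, hcomp, ← hh₀]
    rfl
  · intro h hh
    apply Ideal.Quotient.algHom_ext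
    ext1 p
    obtain ⟨i, j⟩ := p
    have h1 : (h.comp (Ideal.Quotient.mkₐ k J)) (MvPolynomial.X (i, j)) =
        tensorCoord b B j (f (π (MvPolynomial.X i))) := by
      rw [AlgHom.comp_apply, ← hX, ← tensorCoord_map, ← he, AlgHom.comp_apply,
        ← AlgHom.comp_apply, hh]
    exact h1.trans (hX₀ (i, j)).symm

end FatMotive

namespace FatMotive

variable {k : Type u} [Field k]

/-! ### Gluing morphisms over a field -/

section Gluing

/-- A jointly surjective family of open immersions of schemes over `k`. -/
structure IsOpenFamily {T : Over (Base k)} {ι : Type u} {W : ι → Over (Base k)}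
    (c : ∀ i, W i ⟶ T) : Prop where
  isOpenImmersion : ∀ i, IsOpenImmersion (c i).left
  exists_eq : ∀ x : T.left, ∃ i, ∃ y : (W i).left, (c i).left y = x

variable {T X : Over (Base k)} {ι : Type u} {W : ι → Over (Base k)} {c : ∀ i, W i ⟶ T}

/-- The open cover given by a jointly surjective family of open immersions. -/
noncomputable def IsOpenFamily.cover (h : IsOpenFamily c) : T.left.OpenCover where
  I₀ := ι
  X i := (W i).left
  f i := (c i).left
  mem₀ := by
    rw [Scheme.presieve₀_mem_precoverage_iff]
    exact ⟨fun x => h.exists_eq x, h.isOpenImmersion⟩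

theorem IsOpenFamily.hom_ext (h : IsOpenFamily c) {f g : T ⟶ X} (e : ∀ i, c i ≫ f = c i ≫ g) :
    f = g := by
  ext1
  exact Scheme.Cover.hom_ext h.cover _ _ fun i => congrArg CommaMorphism.left (e i)

/-- Compatibility is asked on all test schemes `V`, which suits the functorial arguments below; only
the fibre products are used. -/
theorem IsOpenFamily.exists_glue (h : IsOpenFamily c) (f : ∀ i, W i ⟶ X)
    (e : ∀ (i j : ι) (V : Over (Base k)) (a : V ⟶ W i) (b : V ⟶ W j),
      a ≫ c i = b ≫ c j → a ≫ f i = b ≫ f j) : ∃ g : T ⟶ X, ∀ i, c i ≫ g = f i := by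
  let g : T.left ⟶ X.left := Scheme.Cover.glueMorphisms h.cover (fun i => (f i).left) (by
    intro i j
    let V : Over (Base k) := Over.mk (pullback.fst (c i).left (c j).left ≫ (W i).hom)
    let a : V ⟶ W i := Over.homMk (pullback.fst _ _) rfl
    let b : V ⟶ W j := Over.homMk (pullback.snd (c i).left (c j).left) (by
      simp only [V, Over.mk_hom]
      rw [← Over.w (c i), ← Over.w (c j), pullback.condition_assoc])
    exact congrArg CommaMorphism.left (e i j V a b (by ext1; exact pullback.condition)))
  have hg : ∀ i, (c i).left ≫ g = (f i).left := fun i =>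
    Scheme.Cover.ι_glueMorphisms h.cover _ _ i
  refine ⟨Over.homMk g ?_, fun i => by ext1; exact hg i⟩
  refine Scheme.Cover.hom_ext h.cover _ _ fun i => ?_
  change (c i).left ≫ g ≫ X.hom = (c i).left ≫ T.hom
  rw [reassoc_of% hg i, Over.w, Over.w]

theorem isOpenFamily_openSub (U : ι → T.left.Opens) (hU : ⨆ i, U i = ⊤) :
    IsOpenFamily fun i => openSub.ι T (U i) where
  isOpenImmersion i := inferInstanceAs (IsOpenImmersion (U i).ι)
  exists_eq x := by
    have : x ∈ ⨆ i, U i := hU ▸ trivial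
    obtain ⟨i, hi⟩ := TopologicalSpace.Opens.mem_iSup.1 this
    exact ⟨i, ⟨x, hi⟩, rfl⟩

theorem isOpenFamily_affineOpens (T : Over (Base k)) :
    IsOpenFamily fun U : T.left.affineOpens => openSub.ι T U.1 :=
  isOpenFamily_openSub _ (iSup_affineOpens_eq_top T.left)

theorem isPullback_whiskerLeft (z : Over (Base k)) {V T : Over (Base k)} (c : V ⟶ T) :
    IsPullback (z ◁ c) (snd z V) (snd z T) c :=
  .of_isLimit' ⟨by simp⟩ (PullbackCone.IsLimit.mk _
    (fun s => lift (s.fst ≫ fst z T) s.snd)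
    (fun s => by
      apply CartesianMonoidalCategory.hom_ext
      · simp
      · simpa using s.condition.symm)
    (fun s => by simp)
    (fun s m h₁ h₂ => by
      apply CartesianMonoidalCategory.hom_ext
      · simp [← h₁]
      · simpa using h₂))

theorem IsOpenFamily.whiskerLeft (h : IsOpenFamily c) (z : Over (Base k)) :
    IsOpenFamily fun i => z ◁ c i where
  isOpenImmersion i := by
    have := h.isOpenImmersion i
    exact MorphismProperty.of_isPullback
      ((isPullback_whiskerLeft z (c i)).map (Over.forget _)).flip this
  exists_eq x := by
    obtain ⟨i, y, hy⟩ := h.exists_eq ((snd z T).left x)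
    obtain ⟨v, hv, -⟩ := Scheme.exists_preimage_of_isPullback
      ((isPullback_whiskerLeft z (c i)).map (Over.forget _)) x y hy.symm
    exact ⟨i, v, hv⟩

end Gluing

/-! ### Representability of arcs -/

/-- A morphism `z × S ⟶ X` which makes `S` represent `T ↦ X(z × T)` on all schemes over `k`. -/
def IsArc {z X S : Over (Base k)} (ev : z ⊗ S ⟶ X) : Prop :=
  ∀ T : Over (Base k), Function.Bijective (fun a : T ⟶ S => (z ◁ a) ≫ ev)

section Arc

variable {z X S : Over (Base k)}

/-- Injectivity on all test schemes forces locally found arcs to agree on overlaps, so they glue;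
this is why surjectivity may be checked locally on `T`. -/
theorem isArc_of_local (ev : z ⊗ S ⟶ X)
    (hinj : ∀ T : Over (Base k), Function.Injective (fun a : T ⟶ S => (z ◁ a) ≫ ev))
    (hex : ∀ (T : Over (Base k)) (b : z ⊗ T ⟶ X), ∃ (ι : Type u) (W : ι → Over (Base k))
      (c : ∀ i, W i ⟶ T), IsOpenFamily c ∧ ∀ i, ∃ a : W i ⟶ S, (z ◁ a) ≫ ev = (z ◁ c i) ≫ b) :
    IsArc ev := by
  refine fun T => ⟨hinj T, fun b => ?_⟩
  obtain ⟨ι, W, c, hc, h⟩ := hex T b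
  choose a ha using h
  obtain ⟨g, hg⟩ := hc.exists_glue a (by
    intro i j V p q hpq
    apply hinj V
    change (z ◁ (p ≫ a i)) ≫ ev = (z ◁ (q ≫ a j)) ≫ ev
    rw [whiskerLeft_comp, whiskerLeft_comp, Category.assoc, Category.assoc, ha, ha,
      ← whiskerLeft_comp_assoc, ← whiskerLeft_comp_assoc, hpq])
  refine ⟨g, (hc.whiskerLeft z).hom_ext fun i => ?_⟩
  rw [← ha i, ← hg i, whiskerLeft_comp, Category.assoc]

theorem isArc_of_affine (ev : z ⊗ S ⟶ X)
    (h : ∀ T : Over (Base k), IsAffine T.left →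
      Function.Bijective (fun a : T ⟶ S => (z ◁ a) ≫ ev)) : IsArc ev := by
  refine isArc_of_local ev (fun T a a' haa => ?_) fun T b => ?_
  · refine (isOpenFamily_affineOpens T).hom_ext fun U => ?_
    apply (h (openSub T U.1) U.2).1
    change (z ◁ (_ ≫ a)) ≫ ev = (z ◁ (_ ≫ a')) ≫ ev
    rw [whiskerLeft_comp, whiskerLeft_comp, Category.assoc, Category.assoc]
    exact congrArg _ haa
  · exact ⟨_, _, _, isOpenFamily_affineOpens T, fun U => (h (openSub T U.1) U.2).2 _⟩

theorem bijective_of_iso {T T' : Over (Base k)} (e : T ≅ T') (ev : z ⊗ S ⟶ X)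
    (h : Function.Bijective (fun a : T ⟶ S => (z ◁ a) ≫ ev)) :
    Function.Bijective (fun a : T' ⟶ S => (z ◁ a) ≫ ev) := by
  constructor
  · intro a a' haa
    have haa : (z ◁ a) ≫ ev = (z ◁ a') ≫ ev := haa
    rw [← cancel_epi e.hom]
    apply h.1
    simp [haa]
  · intro b
    obtain ⟨a, ha⟩ := h.2 ((z ◁ e.hom) ≫ b)
    have ha : (z ◁ a) ≫ ev = (z ◁ e.hom) ≫ b := ha
    refine ⟨e.inv ≫ a, ?_⟩
    simp [ha]

theorem IsArc.of_iso {z' X' : Over (Base k)} {ev : z ⊗ S ⟶ X} (h : IsArc ev) (e : z' ≅ z)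
    (f : X ≅ X') : IsArc ((e.hom ▷ S) ≫ ev ≫ f.hom) := by
  intro T
  have key : ∀ a : T ⟶ S, (z' ◁ a) ≫ (e.hom ▷ S) ≫ ev ≫ f.hom =
      (e.hom ▷ T) ≫ ((z ◁ a) ≫ ev) ≫ f.hom := fun a => by
    rw [Category.assoc, whisker_exchange_assoc]
  simp only [key]
  constructor
  · intro a a' haa
    apply (h T).1
    exact (cancel_mono f.hom).1 ((cancel_epi (e.hom ▷ T)).1 haa)
  · intro b
    obtain ⟨a, ha⟩ := (h T).2 ((e.inv ▷ T) ≫ b ≫ f.inv)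
    refine ⟨a, ?_⟩
    have ha : (z ◁ a) ≫ ev = (e.inv ▷ T) ≫ b ≫ f.inv := ha
    simp [ha]

/-! ### Arc schemes of affine schemes -/

/-- The spectrum of a `k`-algebra as a scheme over `k`. -/
noncomputable def specFunctor (k : Type u) [Field k] : (CommAlgCat.{u} k)ᵒᵖ ⥤ Over (Base k) :=
  algSpec (CommRingCat.of k)

noncomputable instance : (specFunctor k).Braided := braidedAlgSpec (R := CommRingCat.of k)

instance : (specFunctor k).Full := algSpec.instFull (R := CommRingCat.of k)

instance : (specFunctor k).Faithful := algSpec.instFaithful (R := CommRingCat.of k)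

theorem exists_specFunctor_iso (T : Over (Base k)) [IsAffine T.left] :
    ∃ B : CommAlgCat.{u} k, Nonempty ((specFunctor k).obj (op B) ≅ T) := by
  obtain ⟨⟨B⟩, ⟨e⟩⟩ := essImage_algSpec.2 ‹IsAffine T.left›
  exact ⟨B, ⟨e⟩⟩

/-- `Spec` is fully faithful and turns tensor products into products, so the universal property of
the algebra `W` is that of the arc scheme on affine tests, and these suffice. -/
theorem isArc_specFunctor (R W A : CommAlgCat.{u} k) (e : A ⟶ R ⊗ W)
    (he : ∀ (B : CommAlgCat.{u} k) (f : A ⟶ R ⊗ B), ∃! h : W ⟶ B, e ≫ (R ◁ h) = f) :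
    IsArc (Functor.LaxMonoidal.μ (specFunctor k) (op R) (op W) ≫
      (specFunctor k).map (Quiver.Hom.op e : op R ⊗ op W ⟶ op A)) := by
  apply isArc_of_affine
  intro T hT
  obtain ⟨B, ⟨et⟩⟩ := exists_specFunctor_iso T
  apply bijective_of_iso et
  have key : ∀ h : W ⟶ B, ((specFunctor k).obj (op R) ◁
      (specFunctor k).map h.op) ≫
        Functor.LaxMonoidal.μ (specFunctor k) (op R) (op W) ≫
        (specFunctor k).map (Quiver.Hom.op e : op R ⊗ op W ⟶ op A) =
      Functor.LaxMonoidal.μ (specFunctor k) (op R) (op B) ≫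
        (specFunctor k).map
          (Quiver.Hom.op (e ≫ (R ◁ h)) : op R ⊗ op B ⟶ op A) := by
    intro h
    rw [Functor.LaxMonoidal.μ_natural_right_assoc, ← Functor.map_comp]
    rfl
  constructor
  · intro a a' haa
    obtain ⟨h, rfl⟩ := (specFunctor k).map_surjective a
    obtain ⟨h', rfl⟩ := (specFunctor k).map_surjective a'
    have haa := ((key h.unop).symm.trans haa).trans (key h'.unop)
    rw [cancel_epi] at haa
    have haa := Quiver.Hom.op_inj ((specFunctor k).map_injective haa)
    have := (he B _).unique haa rfl
    rw [← Quiver.Hom.op_unop h, this]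
    rfl
  · intro b
    obtain ⟨f, hf⟩ := (specFunctor k).map_surjective
      (Functor.OplaxMonoidal.δ (specFunctor k) (op R) (op B) ≫ b)
    obtain ⟨h, hh, -⟩ := he B f.unop
    refine ⟨(specFunctor k).map h.op, (key h).trans ?_⟩
    rw [hh]
    exact (congrArg (_ ≫ ·) hf).trans (Functor.Monoidal.μ_δ_assoc _ _ _ _)

theorem exists_isArc_of_isAffine [IsFinite z.hom] [IsAffine X.left] [LocallyOfFiniteType X.hom] :
    ∃ (S : Over (Base k)) (ev : z ⊗ S ⟶ X), IsAffine S.left ∧ LocallyOfFiniteType S.hom ∧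
      IsArc ev := by
  have : IsAffine z.left := isAffine_of_isAffineHom z.hom
  obtain ⟨R, ⟨er⟩⟩ := exists_specFunctor_iso z
  obtain ⟨A, ⟨ex⟩⟩ := exists_specFunctor_iso X
  have hR : Module.Finite k R := by
    have h : IsFinite ((specFunctor k).obj (op R)).hom := by
      rw [← Over.w er.hom]
      have : IsIso er.hom.left := inferInstanceAs (IsIso ((Over.forget _).map er.hom))
      infer_instance
    have h := (IsFinite.SpecMap_iff (CommRingCat.ofHom (algebraMap k R))).1 h
    exact RingHom.finite_algebraMap.1 h
  have hA : Algebra.FiniteType k A := by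
    have h : LocallyOfFiniteType ((specFunctor k).obj (op A)).hom := by
      rw [← Over.w ex.hom]
      have : IsIso ex.hom.left := inferInstanceAs (IsIso ((Over.forget _).map ex.hom))
      infer_instance
    have h := (HasRingHomProperty.Spec_iff (P := @LocallyOfFiniteType)
      (φ := CommRingCat.ofHom (algebraMap k A))).1 h
    exact RingHom.finiteType_algebraMap.1 h
  obtain ⟨W, _, _, hW, e, he⟩ := exists_weilRestriction_algebra k R A
  refine ⟨(specFunctor k).obj (op (.of k W)), _, inferInstanceAs (IsAffine (Spec _)),
    ?_, (isArc_specFunctor R (.of k W) A (CommAlgCat.ofHom e) fun B f => ?_).of_iso er.symm ex⟩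
  · exact (HasRingHomProperty.Spec_iff (P := @LocallyOfFiniteType)
      (φ := CommRingCat.ofHom (algebraMap k W))).2 (RingHom.finiteType_algebraMap.2 hW)
  · obtain ⟨h, hh, huniq⟩ := he B f.hom
    exact ⟨CommAlgCat.ofHom h, CommAlgCat.hom_ext hh, fun g hg => CommAlgCat.hom_ext
      (huniq g.hom (congrArg CommAlgCat.Hom.hom hg))⟩

end Arc

/-! ### The constant section of a fat point -/

section Section

variable {z X : Over (Base k)} (p : 𝟙_ (Over (Base k)) ⟶ z)

/-- The section `T ⟶ z × T` given by a rational point of `z`. -/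
noncomputable def constSection (T : Over (Base k)) : T ⟶ z ⊗ T := lift (toUnit T ≫ p) (𝟙 T)

theorem constSection_naturality {T S : Over (Base k)} (a : T ⟶ S) :
    constSection p T ≫ (z ◁ a) = a ≫ constSection p S := by
  apply CartesianMonoidalCategory.hom_ext <;> simp [constSection]

/-- The constant section is the base change of `p` along `z × T ⟶ z`, so it inherits the stable
properties of `p`. -/
theorem isPullback_constSection (T : Over (Base k)) :
    IsPullback (constSection p T) (toUnit T) (fst z T) p :=
  .of_isLimit' ⟨by simp [constSection]⟩ (PullbackCone.IsLimit.mk _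
    (fun s => s.fst ≫ snd z T)
    (fun s => by
      apply CartesianMonoidalCategory.hom_ext
      · simp only [constSection, Category.assoc, lift_fst, s.condition, comp_toUnit_assoc]
        congr 1
        exact toUnit_unique _ _
      · simp [constSection])
    (fun s => toUnit_unique _ _)
    (fun s m h₁ h₂ => by simp [← h₁, constSection]))

/-- As `z` has one point, `p` is surjective, and surjectivity survives base change. Thus `z × T` has
no points beyond those of `T`. -/
theorem constSection_surjective [Subsingleton z.left] (T : Over (Base k)) :
    Function.Surjective (constSection p T).left := by
  have : Surjective p.left := ⟨fun y =>
    ⟨(IsLocalRing.closedPoint k : Spec (CommRingCat.of k)), Subsingleton.elim _ _⟩⟩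
  have h : Surjective (constSection p T).left :=
    MorphismProperty.of_isPullback ((isPullback_constSection p T).map (Over.forget _)).flip this
  exact h.1

/-- Factoring through an open is a condition on points only, and every point of `z × T` lies on the
constant section. -/
theorem exists_lift_of_constSection [Subsingleton z.left] {V T : Over (Base k)} (i : V ⟶ X)
    [IsOpenImmersion i.left] (b : z ⊗ T ⟶ X)
    (h : Set.range (constSection p T ≫ b).left ⊆ Set.range i.left) :
    ∃ d : z ⊗ T ⟶ V, d ≫ i = b := by
  have hr : Set.range b.left ⊆ Set.range i.left := by
    rintro _ ⟨y, rfl⟩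
    obtain ⟨t, rfl⟩ := constSection_surjective p T y
    exact h ⟨t, by simp⟩
  refine ⟨Over.homMk (IsOpenImmersion.lift i.left b.left hr) ?_, ?_⟩
  · rw [← Over.w i, IsOpenImmersion.lift_fac_assoc, Over.w b]
  · ext1
    exact IsOpenImmersion.lift_fac _ _ _

theorem over_mono_of_left {V X : Over (Base k)} (i : V ⟶ X) [IsOpenImmersion i.left] : Mono i :=
  Over.mono_of_mono_left i

/-- An arc lies in the open `V` as soon as its restriction to the constant section does. So the arc
scheme of `V` is the inverse image of `V` in that of `V'`, which is what makes local arc schemes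
glue. -/
theorem IsArc.isPullback [Subsingleton z.left] {V V' S S' : Over (Base k)} {ev : z ⊗ S ⟶ V}
    {ev' : z ⊗ S' ⟶ V'} (h : IsArc ev) (h' : IsArc ev') (i : V ⟶ V') [IsOpenImmersion i.left]
    (m : S ⟶ S') (hm : (z ◁ m) ≫ ev' = ev ≫ i) :
    IsPullback m (constSection p S ≫ ev) (constSection p S' ≫ ev') i := by
  have := over_mono_of_left i
  refine .of_isLimit' ⟨?_⟩ ?_
  · rw [← reassoc_of% constSection_naturality p m, hm, Category.assoc]
  have hlift : ∀ s : PullbackCone (constSection p S' ≫ ev') i,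
      ∃ a : s.pt ⟶ S, ((z ◁ a) ≫ ev) ≫ i = (z ◁ s.fst) ≫ ev' := by
    intro s
    obtain ⟨d, hd⟩ := exists_lift_of_constSection p i ((z ◁ s.fst) ≫ ev') (by
      rw [reassoc_of% constSection_naturality p s.fst, s.condition]
      rintro _ ⟨y, rfl⟩
      exact ⟨s.snd.left y, by simp⟩)
    obtain ⟨a, ha⟩ := (h s.pt).2 d
    exact ⟨a, (congrArg (· ≫ i) ha).trans hd⟩
  choose l hl using hlift
  have hl' : ∀ s, l s ≫ m = s.fst := by
    intro s
    apply (h' s.pt).1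
    change (z ◁ (l s ≫ m)) ≫ ev' = _
    rw [whiskerLeft_comp, Category.assoc, hm, ← Category.assoc, hl]
  refine PullbackCone.IsLimit.mk _ l hl' (fun s => ?_) (fun s n h₁ h₂ => ?_)
  · rw [← cancel_mono i, ← s.condition, ← reassoc_of% constSection_naturality p (l s),
      Category.assoc, Category.assoc, ← Category.assoc _ ev, hl,
      reassoc_of% constSection_naturality p s.fst]
  · apply (h s.pt).1
    change (z ◁ n) ≫ ev = (z ◁ l s) ≫ ev
    rw [← cancel_mono i, hl, Category.assoc, ← hm, ← h₁, whiskerLeft_comp, Category.assoc]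

end Section

end FatMotive

namespace FatMotive

variable {k : Type u} [Field k]

/-! ### Gluing arc schemes -/

/-- The inclusion of open subschemes. -/
noncomputable def openSub.homOfLE (X : Over (Base k)) {U V : X.left.Opens} (h : U ≤ V) :
    openSub X U ⟶ openSub X V :=
  Over.homMk (X.left.homOfLE h) (by simp [openSub])

theorem openSub.homOfLE_ι (X : Over (Base k)) {U V : X.left.Opens} (h : U ≤ V) :
    openSub.homOfLE X h ≫ openSub.ι X V = openSub.ι X U := by
  ext1
  exact X.left.homOfLE_ι h

instance (X : Over (Base k)) {U V : X.left.Opens} (h : U ≤ V) :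
    IsOpenImmersion (openSub.homOfLE X h).left :=
  inferInstanceAs (IsOpenImmersion (X.left.homOfLE h))

instance (X : Over (Base k)) (U : X.left.Opens) : IsOpenImmersion (openSub.ι X U).left :=
  inferInstanceAs (IsOpenImmersion U.ι)

instance (X : Over (Base k)) (U : X.left.Opens) : Mono (openSub.ι X U) :=
  Over.mono_of_mono_left _

theorem exists_lift_openSub {T X : Over (Base k)} (U : X.left.Opens) (r : T ⟶ X)
    (h : ∀ t, r.left t ∈ U) : ∃ d : T ⟶ openSub X U, d ≫ openSub.ι X U = r := by
  have hr : Set.range r.left ⊆ Set.range U.ι := by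
    rintro _ ⟨t, rfl⟩
    simpa using h t
  let l : T.left ⟶ U.toScheme := IsOpenImmersion.lift U.ι r.left hr
  refine ⟨Over.homMk l ?_, ?_⟩
  · exact (IsOpenImmersion.lift_fac_assoc U.ι r.left hr X.hom).trans (Over.w r)
  · ext1
    exact IsOpenImmersion.lift_fac U.ι r.left hr

theorem openSub.ι_apply_mem {T X : Over (Base k)} (U : X.left.Opens) (d : T ⟶ openSub X U)
    (t : T.left) : (d ≫ openSub.ι X U).left t ∈ U :=
  (d.left t).2

/-- A choice of arc schemes for all affine open subschemes of `X`. -/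
structure LocalArcs (z X : Over (Base k)) where
  /-- the local arc schemes -/
  space : X.left.affineOpens → Over (Base k)
  /-- the local universal arcs -/
  ev : ∀ V, z ⊗ space V ⟶ openSub X V.1
  isAffine : ∀ V, IsAffine (space V).left
  locallyOfFiniteType : ∀ V, LocallyOfFiniteType (space V).hom
  isArc : ∀ V, IsArc (ev V)

theorem nonempty_localArcs (z X : Over (Base k)) [IsFinite z.hom] [LocallyOfFiniteType X.hom] :
    Nonempty (LocalArcs z X) := by
  have h : ∀ V : X.left.affineOpens, ∃ (S : Over (Base k)) (ev : z ⊗ S ⟶ openSub X V.1),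
      IsAffine S.left ∧ LocallyOfFiniteType S.hom ∧ IsArc ev := by
    intro V
    have : IsAffine (openSub X V.1).left := V.2
    have : LocallyOfFiniteType (openSub X V.1).hom :=
      inferInstanceAs (LocallyOfFiniteType (V.1.ι ≫ X.hom))
    exact exists_isArc_of_isAffine
  choose S ev h₁ h₂ h₃ using h
  exact ⟨⟨S, ev, h₁, h₂, h₃⟩⟩

namespace LocalArcs

variable {z X : Over (Base k)} (A : LocalArcs z X)

/-- The transition morphisms between local arc schemes. -/
noncomputable def trans {V V' : X.left.affineOpens} (h : V ≤ V') : A.space V ⟶ A.space V' :=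
  ((A.isArc V' (A.space V)).2 (A.ev V ≫ openSub.homOfLE X h)).choose

theorem trans_ev {V V' : X.left.affineOpens} (h : V ≤ V') :
    (z ◁ A.trans h) ≫ A.ev V' = A.ev V ≫ openSub.homOfLE X h :=
  ((A.isArc V' (A.space V)).2 (A.ev V ≫ openSub.homOfLE X h)).choose_spec

theorem trans_ev_ι {V V' : X.left.affineOpens} (h : V ≤ V') :
    (z ◁ A.trans h) ≫ A.ev V' ≫ openSub.ι X _ = A.ev V ≫ openSub.ι X _ := by
  rw [← Category.assoc, trans_ev, Category.assoc, openSub.homOfLE_ι]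

theorem hom_ext {V : X.left.affineOpens} {T : Over (Base k)} {a b : T ⟶ A.space V}
    (h : (z ◁ a) ≫ A.ev V ≫ openSub.ι X _ = (z ◁ b) ≫ A.ev V ≫ openSub.ι X _) : a = b := by
  apply (A.isArc V T).1
  change (z ◁ a) ≫ A.ev V = (z ◁ b) ≫ A.ev V
  rw [← cancel_mono (openSub.ι X V.1), Category.assoc, Category.assoc, h]

theorem trans_self (V : X.left.affineOpens) : A.trans (le_refl V) = 𝟙 _ := by
  apply A.hom_ext
  rw [trans_ev_ι, whiskerLeft_id, Category.id_comp]

theorem trans_trans {U V W : X.left.affineOpens} (h : U ≤ V) (h' : V ≤ W) :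
    A.trans h ≫ A.trans h' = A.trans (h.trans h') := by
  apply A.hom_ext
  rw [trans_ev_ι, whiskerLeft_comp, Category.assoc, trans_ev_ι, trans_ev_ι]

variable (p : 𝟙_ (Over (Base k)) ⟶ z) [Subsingleton z.left]

/-- The projection of a local arc scheme. -/
noncomputable def proj (V : X.left.affineOpens) : A.space V ⟶ openSub X V.1 :=
  constSection p _ ≫ A.ev V

theorem isPullback_trans {V V' : X.left.affineOpens} (h : V ≤ V') :
    IsPullback (A.trans h) (A.proj p V) (A.proj p V') (openSub.homOfLE X h) :=
  (A.isArc V).isPullback p (A.isArc V') _ _ (A.trans_ev h)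

/-- The gluing data of the local arc schemes. -/
noncomputable def gluingData : X.left.directedAffineCover.RelativeGluingData where
  functor :=
    { obj V := (A.space V).left
      map h := (A.trans (leOfHom h)).left
      map_id _ := congrArg CommaMorphism.left (A.trans_self _)
      map_comp f g :=
        congrArg CommaMorphism.left (A.trans_trans (leOfHom f) (leOfHom g)).symm }
  natTrans :=
    { app V := (A.proj p V).left
      naturality _ _ h := congrArg CommaMorphism.left (A.isPullback_trans p (leOfHom h)).w }
  equifibered _ _ h := (A.isPullback_trans p (leOfHom h)).map (Over.forget _)

/-- The arc scheme obtained by gluing local arc schemes. -/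
noncomputable def glued : Over (Base k) := Over.mk ((A.gluingData p).toBase ≫ X.hom)

/-- The projection of the glued arc scheme. -/
noncomputable def toBase : A.glued p ⟶ X := Over.homMk (A.gluingData p).toBase rfl

/-- The inclusion of a local arc scheme. -/
noncomputable def incl (V : X.left.affineOpens) : A.space V ⟶ A.glued p :=
  Over.homMk (colimit.ι (A.gluingData p).functor V) (by
    have h := (A.gluingData p).ι_toBase V
    change colimit.ι (A.gluingData p).functor V ≫ (A.gluingData p).toBase ≫ X.hom = _
    rw [reassoc_of% h]
    exact Over.w (A.proj p V))

theorem isPullback_incl (V : X.left.affineOpens) :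
    IsPullback (A.proj p V) (A.incl p V) (openSub.ι X V.1) (A.toBase p) := by
  have h := (A.gluingData p).isPullback_natTrans_ι_toBase V
  exact .of_map (Over.forget _) (by ext1; exact h.w) h

instance (V : X.left.affineOpens) : IsOpenImmersion (A.incl p V).left :=
  MorphismProperty.of_isPullback (P := @IsOpenImmersion)
    ((A.isPullback_incl p V).map (Over.forget _)) (inferInstanceAs (IsOpenImmersion V.1.ι))

instance (V : X.left.affineOpens) : Mono (A.incl p V) := Over.mono_of_mono_left _

theorem trans_incl {V V' : X.left.affineOpens} (h : V ≤ V') :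
    A.trans h ≫ A.incl p V' = A.incl p V := by
  ext1
  exact colimit.w (A.gluingData p).functor (homOfLE h)

theorem isOpenFamily_incl : IsOpenFamily (A.incl p) where
  isOpenImmersion V := inferInstance
  exists_eq x := by
    obtain ⟨V, y, hy⟩ := (A.gluingData p).cover.exists_eq x
    exact ⟨V, y, hy⟩

/-- Over an affine open `V` the projection is `A.space V`, which is affine. Separatedness and
quasi-compactness of the glued scheme follow. -/
theorem isAffineHom_toBase : IsAffineHom (A.toBase p).left := by
  have hV : ∀ V : X.left.directedAffineCover.I₀, IsAffine (X.left.directedAffineCover.X V) :=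
    fun V => V.2
  refine @HasAffineProperty.of_openCover _ _ instHasAffinePropertyIsAffineHomIsAffine.{u}
    _ _ _ X.left.directedAffineCover hV fun V => ?_
  have h := ((A.isPullback_incl p V).map (Over.forget _)).flip
  have : IsAffine (A.space V).left := A.isAffine V
  exact @IsAffine.of_isIso _ _ h.isoPullback.inv (Iso.isIso_inv _) this

theorem isAlgScheme_glued [IsAlgScheme X] : IsAlgScheme (A.glued p) := by
  have := A.isAffineHom_toBase p
  have h : (A.glued p).hom = (A.toBase p).left ≫ X.hom := rfl
  refine ⟨by rw [h]; infer_instance, ?_, by rw [h]; infer_instance⟩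
  have : IsZariskiLocalAtSource @LocallyOfFiniteType.{u} :=
    HasRingHomProperty.instIsZariskiLocalAtSource (P := @LocallyOfFiniteType.{u})
  rw [IsZariskiLocalAtSource.iff_of_openCover (P := @LocallyOfFiniteType.{u})
    (A.isOpenFamily_incl p).cover]
  intro V
  change LocallyOfFiniteType ((A.incl p V).left ≫ (A.glued p).hom)
  rw [Over.w]
  exact A.locallyOfFiniteType V

theorem exists_ev [IsAlgScheme X] : ∃ ev : z ⊗ A.glued p ⟶ X,
    ∀ V, (z ◁ A.incl p V) ≫ ev = A.ev V ≫ openSub.ι X V.1 := by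
  refine ((A.isOpenFamily_incl p).whiskerLeft z).exists_glue _ ?_
  intro V V' T a b hab
  have : X.left.IsSeparated := ⟨by
    rw [← terminal.comp_from X.hom]
    infer_instance⟩
  have : IsAffineHom (pullback.diagonal (terminal.from X.left)) := inferInstance
  -- Separatedness of `X` makes `V ∩ V'` affine, so it has its own local arc scheme; both `a` and
  -- `b` factor through it, and the two universal arcs restrict to the same one there.
  let V'' : X.left.affineOpens := ⟨V.1 ⊓ V'.1, V.2.inf V'.2⟩
  have h : V'' ≤ V := inf_le_left (a := V.1)
  have h' : V'' ≤ V' := inf_le_right (a := V.1)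
  have hs : (a ≫ snd _ _) ≫ A.incl p V = (b ≫ snd _ _) ≫ A.incl p V' := by
    simpa using congrArg (· ≫ snd _ _) hab
  have hf : a ≫ fst _ _ = b ≫ fst _ _ := by
    simpa using congrArg (· ≫ fst _ _) hab
  obtain ⟨t, ht⟩ : ∃ t : T ⟶ A.space V'', t ≫ A.incl p V'' = (a ≫ snd _ _) ≫ A.incl p V := by
    obtain ⟨d, hd⟩ := exists_lift_openSub V''.1 (((a ≫ snd _ _) ≫ A.incl p V) ≫ A.toBase p)
      fun t => by
        refine ⟨?_, ?_⟩
        · rw [Category.assoc, ← (A.isPullback_incl p V).w, ← Category.assoc]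
          exact openSub.ι_apply_mem _ _ t
        · rw [hs, Category.assoc, ← (A.isPullback_incl p V').w, ← Category.assoc]
          exact openSub.ι_apply_mem _ _ t
    exact ⟨_, (A.isPullback_incl p V'').lift_snd d _ hd⟩
  have h₁ : t ≫ A.trans h = a ≫ snd _ _ := by
    rw [← cancel_mono (A.incl p V), Category.assoc, trans_incl, ht]
  have h₂ : t ≫ A.trans h' = b ≫ snd _ _ := by
    rw [← cancel_mono (A.incl p V'), Category.assoc, trans_incl, ht, hs]
  have h₃ : a = lift (a ≫ fst _ _) t ≫ (z ◁ A.trans h) := by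
    apply CartesianMonoidalCategory.hom_ext <;> simp [h₁]
  have h₄ : b = lift (a ≫ fst _ _) t ≫ (z ◁ A.trans h') := by
    apply CartesianMonoidalCategory.hom_ext <;> simp [h₂, hf]
  rw [h₃, h₄, Category.assoc, Category.assoc, trans_ev_ι, trans_ev_ι]

/-- The projection can be read off from the universal arc, so two maps to the glued scheme that
define the same arc have the same projection to `X`. -/
theorem constSection_ev {ev : z ⊗ A.glued p ⟶ X}
    (hev : ∀ V, (z ◁ A.incl p V) ≫ ev = A.ev V ≫ openSub.ι X V.1) :
    constSection p _ ≫ ev = A.toBase p := by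
  refine (A.isOpenFamily_incl p).hom_ext fun V => ?_
  rw [← reassoc_of% constSection_naturality p, hev, ← (A.isPullback_incl p V).w, proj,
    Category.assoc]

/-- The open subschemes of `T` obtained as the inverse images of the affine opens of `X`. -/
theorem isOpenFamily_preimage {T : Over (Base k)} (r : T ⟶ X) :
    IsOpenFamily fun V : X.left.affineOpens => openSub.ι T (r.left ⁻¹ᵁ V.1) := by
  apply isOpenFamily_openSub
  rw [← Scheme.Hom.preimage_iSup, iSup_affineOpens_eq_top]
  rfl

/-- The restriction of an arc to the constant section is a morphism `T ⟶ X`. Over the inverse image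
of an affine `V` the arc lies in `V`, where the local arc scheme represents it; these inverse images
cover `T`. -/
theorem isArc_glued {ev : z ⊗ A.glued p ⟶ X}
    (hev : ∀ V, (z ◁ A.incl p V) ≫ ev = A.ev V ≫ openSub.ι X V.1) : IsArc ev := by
  have hρ := A.constSection_ev p hev
  refine isArc_of_local ev (fun T a a' haa => ?_) fun T b => ?_
  · have haa : (z ◁ a) ≫ ev = (z ◁ a') ≫ ev := haa
    have hr : a ≫ A.toBase p = a' ≫ A.toBase p := by
      rw [← hρ, ← reassoc_of% constSection_naturality p, haa,
        reassoc_of% constSection_naturality p]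
    refine (isOpenFamily_preimage (a ≫ A.toBase p)).hom_ext fun V => ?_
    obtain ⟨r, hr₁⟩ := exists_lift_openSub V.1
      ((openSub.ι T ((a ≫ A.toBase p).left ⁻¹ᵁ V.1) ≫ a) ≫ A.toBase p) fun t => t.2
    have hr₂ : r ≫ openSub.ι X V.1 = (openSub.ι T _ ≫ a') ≫ A.toBase p := by
      rw [hr₁, Category.assoc, Category.assoc, hr]
    have hl := (A.isPullback_incl p V).lift_snd r _ hr₁
    have hl' := (A.isPullback_incl p V).lift_snd r _ hr₂
    rw [← hl, ← hl']
    congr 1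
    apply A.hom_ext
    rw [← hev, ← whiskerLeft_comp_assoc, ← whiskerLeft_comp_assoc, hl, hl', whiskerLeft_comp,
      whiskerLeft_comp, Category.assoc, Category.assoc, haa]
  · let r := constSection p T ≫ b
    refine ⟨_, _, _, isOpenFamily_preimage r, fun V => ?_⟩
    obtain ⟨d, hd⟩ := exists_lift_of_constSection p (openSub.ι X V.1)
      ((z ◁ openSub.ι T (r.left ⁻¹ᵁ V.1)) ≫ b) (by
        rw [reassoc_of% constSection_naturality p]
        rintro _ ⟨t, rfl⟩
        exact ⟨⟨_, t.2⟩, rfl⟩)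
    obtain ⟨a, ha⟩ := (A.isArc V _).2 d
    have ha : (z ◁ a) ≫ A.ev V = d := ha
    refine ⟨a ≫ A.incl p V, ?_⟩
    rw [whiskerLeft_comp, Category.assoc, hev, ← Category.assoc, ha, hd]

end LocalArcs

theorem exists_isArc (z X : Over (Base k)) [IsFinite z.hom] [Subsingleton z.left]
    (p : 𝟙_ (Over (Base k)) ⟶ z) [IsAlgScheme X] :
    ∃ (S : Over (Base k)) (ev : z ⊗ S ⟶ X), IsAlgScheme S ∧ IsArc ev := by
  obtain ⟨A⟩ := nonempty_localArcs z X
  obtain ⟨ev, hev⟩ := A.exists_ev p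
  exact ⟨_, ev, A.isAlgScheme_glued p, A.isArc_glued p hev⟩

end FatMotive

namespace FatMotive

/-! ### Valuations on lattices of sets -/

section Valuation

variable {L G E ι : Type*} [Lattice L] [CommRing G] {f : LatticeHom L (Set E)} {v : L → G}

/-- `B \ D` is the disjoint union of its part inside `A`, namely `(B ∩ A) \ D`, and its part
outside, `B \ (D ∪ A)`. The embedding into sets supplies distributivity. -/
theorem valuation_sub_eq_add (hf : Function.Injective f)
    (hv : ∀ a b, v a + v b = v (a ⊔ b) + v (a ⊓ b)) (A B D : L) :
    v B - v (B ⊓ D) = (v (B ⊓ A) - v (B ⊓ A ⊓ D)) + (v B - v (B ⊓ (D ⊔ A))) := by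
  have h₁ : B ⊓ (D ⊔ A) = (B ⊓ A) ⊔ (B ⊓ D) := hf (by
    simp only [map_inf, map_sup]
    rw [inf_sup_left, sup_comm])
  have h₂ : B ⊓ A ⊓ D = (B ⊓ A) ⊓ (B ⊓ D) := by
    rw [← inf_inf_distrib_left, inf_assoc]
  have h := hv (B ⊓ A) (B ⊓ D)
  rw [← h₁, ← h₂] at h
  rw [eq_sub_of_add_eq h.symm]
  abel

open Classical in
/-- A valuation on a lattice of sets respects all linear relations between indicator functions,
relatively to a difference `B \ D`. -/
theorem valuation_sum_relative (hf : Function.Injective f)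
    (hv : ∀ a b, v a + v b = v (a ⊔ b) + v (a ⊓ b)) (s : Finset ι) (m : ι → ℤ) (A : ι → L) :
    ∀ (B D : L) (c : ℤ),
      (∀ e ∈ f B, e ∉ f D → c + ∑ i ∈ s, (if e ∈ f (A i) then m i else 0) = 0) →
      (c : G) * (v B - v (B ⊓ D)) + ∑ i ∈ s, (m i : G) * (v (B ⊓ A i) - v (B ⊓ A i ⊓ D)) = 0 := by
  induction s using Finset.induction_on with
  | empty =>
    intro B D c h
    simp only [Finset.sum_empty, add_zero] at h ⊢
    -- If `c ≠ 0`, the hypothesis leaves no point in `B \ D`, so `B ⊓ D = B` and the difference of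
    -- values vanishes.
    by_cases hc : c = 0
    · simp [hc]
    · have : B ⊓ D = B := hf (by
        rw [map_inf]
        exact Set.inter_eq_left.2 fun e he => by_contra fun h' => hc (h e he h'))
      simp [this]
  | insert i s hi ih =>
    intro B D c h
    -- Cut `B \ D` along `A i`: inside, the indicator is constant and `m i` joins `c`; outside, it
    -- vanishes and `A i` joins the part removed.
    have h₁ := ih (B ⊓ A i) D (c + m i) (fun e he he' => by
      rw [map_inf] at he
      have := h e he.1 he'
      rw [Finset.sum_insert hi, if_pos he.2] at this
      linarith)
    have h₂ := ih B (D ⊔ A i) c (fun e he he' => by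
      rw [map_sup] at he'
      have := h e he fun h' => he' (Or.inl h')
      rw [Finset.sum_insert hi, if_neg fun h' => he' (Or.inr h')] at this
      linarith)
    have h₃ : ∀ j, v (B ⊓ A j) - v (B ⊓ A j ⊓ D) =
        (v (B ⊓ A i ⊓ A j) - v (B ⊓ A i ⊓ A j ⊓ D)) +
          (v (B ⊓ A j) - v (B ⊓ A j ⊓ (D ⊔ A i))) := fun j => by
      rw [inf_right_comm B (A i) (A j)]
      exact valuation_sub_eq_add hf hv (A i) (B ⊓ A j) D
    rw [Finset.sum_insert hi, Finset.sum_congr rfl fun j _ => congrArg ((m j : G) * ·) (h₃ j),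
      valuation_sub_eq_add hf hv (A i) B D]
    simp only [mul_add, Finset.sum_add_distrib]
    push_cast at h₁
    linear_combination h₁ + h₂

end Valuation

variable {k : Type u} [Field k]

/-! ### Classes of formal sieves -/

section Classes

theorem class_eq_of_rel {a b : FreeCommRing (Motif k)} (h : GrotRel k a b) :
    (Ideal.Quotient.mk (Ideal.ofRel (GrotRel k)) a : Grot k) = Ideal.Quotient.mk _ b :=
  Ideal.Quotient.eq.2 (Ideal.subset_span ⟨a, b, h, sub_add_cancel a b⟩)

variable {X : Over (Base k)} [IsAlgScheme X]

theorem formalClass_bot : formalClass (⊥ : MSieve X) isFormal_bot = 0 := by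
  have h : (Motif.mk' X ⊥ isFormal_bot).class = (0 : Grot k) :=
    (class_eq_of_rel (.empty X)).trans (map_zero _)
  rw [formalClass, h, map_zero]

theorem formalClass_add {M N : MSieve X} (hM : IsFormal M) (hN : IsFormal N) :
    formalClass M hM + formalClass N hN =
      formalClass (M ⊔ N) (hM.sup hN) + formalClass (M ⊓ N) (hM.inf hN) := by
  have h := class_eq_of_rel (GrotRel.scissor X M N hM hN)
  rw [map_add, map_add] at h
  simp only [formalClass, ← map_add]
  exact congrArg _ h

theorem formalClass_iso {Y : Over (Base k)} [IsAlgScheme Y] {M : MSieve X} {N : MSieve Y}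
    (hM : IsFormal M) (hN : IsFormal N) (e : M.toFunctor ≅ N.toFunctor) (h : IsMotivicHom e.hom)
    (h' : IsMotivicHom e.inv) : formalClass M hM = formalClass N hN :=
  congrArg (algebraMap (Grot k) (LocGrot k))
    (class_eq_of_rel (GrotRel.iso (.mk' X M hM) (.mk' Y N hN) e h h'))

variable (X) in
/-- The lattice of formal sieves on `X`. -/
def formalSublattice : Sublattice (MSieve X) where
  carrier := {M | IsFormal M}
  supClosed' _ hM _ hN := IsFormal.sup hM hN
  infClosed' _ hM _ hN := IsFormal.inf hM hN

variable (X) in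
/-- The set of all points of a formal sieve. -/
def formalPoints : LatticeHom (formalSublattice X)
    (Set (Σ w : (SplitPoint k)ᵒᵖ, (splitRes (points X)).obj w)) where
  toFun M := {e | e.2 ∈ (MSieve.toSplit M.1).obj e.1}
  map_sup' _ _ := rfl
  map_inf' _ _ := rfl

/-- Split points have the same objects as fat points, and a sieve is determined by its sets of
points; passing to fewer morphisms loses nothing. -/
theorem formalPoints_injective : Function.Injective (formalPoints X) := by
  intro M N h
  ext w a
  exact Set.ext_iff.1 h ⟨op ⟨w.unop⟩, a⟩

open Classical in
/-- Linear relations between indicator functions of formal sieves hold for their classes. -/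
theorem sum_formalClass_eq_zero {ι : Type*} (s : Finset ι) (m : ι → ℤ) (C : ι → MSieve X)
    (hC : ∀ i, IsFormal (C i)) (h : ∀ (w : (SplitPoint k)ᵒᵖ) (a : (splitRes (points X)).obj w),
      ∑ i ∈ s, (if a ∈ (MSieve.toSplit (C i)).obj w then m i else 0) = 0) :
    ∑ i ∈ s, (m i : LocGrot k) * formalClass (C i) (hC i) = 0 := by
  have key := valuation_sum_relative (f := formalPoints X)
    (v := fun M => formalClass M.1 M.2) formalPoints_injective
    (fun M N => formalClass_add M.2 N.2) s m (fun i => ⟨C i, hC i⟩)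
    ⟨⊤, isFormal_top⟩ ⟨⊥, isFormal_bot⟩ 0 (fun e _ _ => by
      rw [zero_add]
      exact h e.1 e.2)
  rw [Int.cast_zero, zero_mul, zero_add] at key
  rw [← key]
  refine Finset.sum_congr rfl fun i _ => ?_
  have h₁ : (⟨⊤, isFormal_top⟩ ⊓ ⟨C i, hC i⟩ : formalSublattice X) = ⟨C i, hC i⟩ :=
    Subtype.ext (top_inf_eq (C i))
  have h₂ : (⟨C i, hC i⟩ ⊓ ⟨⊥, isFormal_bot⟩ : formalSublattice X) = ⟨⊥, isFormal_bot⟩ :=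
    Subtype.ext (inf_bot_eq (C i))
  rw [h₁, h₂]
  change _ = (m i : LocGrot k) * (_ - formalClass (⊥ : MSieve X) isFormal_bot)
  rw [formalClass_bot, sub_zero]

open Classical in
theorem indicator_of_pairwise_disjoint {E ι : Type*} [Fintype ι] (C D : ι → Set E)
    (hDC : ∀ i, D i ⊆ C i) (h : Pairwise (Function.onFun Disjoint fun i => C i \ D i)) (a : E) :
    (if a ∈ ⋃ i, C i \ D i then (1 : ℤ) else 0) =
      ∑ i, ((if a ∈ C i then 1 else 0) - (if a ∈ D i then 1 else 0)) := by
  have h₁ : ∀ i, ((if a ∈ C i then 1 else 0) - (if a ∈ D i then 1 else 0) : ℤ) =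
      if a ∈ C i \ D i then 1 else 0 := by
    intro i
    have := @hDC i a
    by_cases h₁ : a ∈ C i <;> by_cases h₂ : a ∈ D i <;> simp_all
  rw [Finset.sum_congr rfl fun i _ => h₁ i]
  split_ifs with ha
  · obtain ⟨i, hi⟩ := Set.mem_iUnion.1 ha
    rw [Finset.sum_eq_single i, if_pos hi]
    · intro j _ hj
      exact if_neg fun hj' => Set.disjoint_left.1 (h hj) hj' hi
    · simp
  · exact (Finset.sum_eq_zero fun i _ => if_neg fun hi => ha (Set.mem_iUnion.2 ⟨i, hi⟩)).symm

open Classical in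
/-- Linear relations between indicator functions of split formal sieves hold for their classes. -/
theorem sum_smul_eq_zero_of_hasClass {ι : Type*} (s : Finset ι) (m : ι → ℤ)
    (F : ι → SplitSieve X) (v : ι → LocGrot k) (hF : ∀ i, HasClass (F i) (v i))
    (h : ∀ (w : (SplitPoint k)ᵒᵖ) (a : (splitRes (points X)).obj w),
      ∑ i ∈ s, m i * (if a ∈ (F i).obj w then 1 else 0) = 0) :
    ∑ i ∈ s, (m i : LocGrot k) * v i = 0 := by
  choose n C D hC hD hDC hF₁ hF₂ hv using hF
  have hind : ∀ i w a, (if a ∈ (F i).obj w then (1 : ℤ) else 0) =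
      ∑ j, ((if a ∈ (MSieve.toSplit (C i j)).obj w then 1 else 0) -
        (if a ∈ (MSieve.toSplit (D i j)).obj w then 1 else 0)) := by
    intro i w a
    rw [hF₁ i w]
    exact indicator_of_pairwise_disjoint (fun j => (MSieve.toSplit (C i j)).obj w)
      (fun j => (MSieve.toSplit (D i j)).obj w) (fun j => hDC i j _) (hF₂ i w) a
  -- Each difference yields two formal sieves of opposite sign; the Boolean is true for `C` and
  -- false for `D`.
  let T : Finset (Σ i, Fin (n i) × Bool) := s.sigma fun _ => Finset.univ
  have key := sum_formalClass_eq_zero (X := X) T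
    (fun t => if t.2.2 then m t.1 else - m t.1)
    (fun t => if t.2.2 then C t.1 t.2.1 else D t.1 t.2.1)
    (fun t => by
      split_ifs
      · exact hC _ _
      · exact hD _ _)
    (fun w a => by
      refine Eq.trans ?_ (h w a)
      rw [Finset.sum_sigma]
      refine Finset.sum_congr rfl fun i _ => ?_
      rw [hind, Finset.mul_sum, Fintype.sum_prod_type]
      refine Finset.sum_congr rfl fun j _ => ?_
      simp only [Fintype.sum_bool, if_true, Bool.false_eq_true, if_false]
      split_ifs <;> ring)
  rw [← key, Finset.sum_sigma]
  refine Finset.sum_congr rfl fun i _ => ?_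
  rw [hv, Finset.mul_sum, Fintype.sum_prod_type]
  refine Finset.sum_congr rfl fun j _ => ?_
  simp [sub_eq_add_neg, mul_add]

/-- Apply the principle of linear relations to `F - F = 0`, with a different decomposition of `F` in
each term. -/
theorem HasClass.unique {F : SplitSieve X} {u v : LocGrot k} (hu : HasClass F u)
    (hv : HasClass F v) : u = v := by
  have key := sum_smul_eq_zero_of_hasClass (X := X) Finset.univ (fun b : Bool => if b then 1 else -1)
    (fun _ => F) (fun b => if b then u else v) (fun b => by cases b <;> assumption)
    (fun w a => by simp)
  simpa [← sub_eq_add_neg, sub_eq_zero] using key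

theorem hasClass_zero {F : SplitSieve X} (h : ∀ w a, a ∉ F.obj w) : HasClass F 0 := by
  refine ⟨0, Fin.elim0, Fin.elim0, fun i => i.elim0, fun i => i.elim0, fun i => i.elim0, fun w => ?_,
    fun _ i => i.elim0, by simp⟩
  rw [Set.iUnion_of_empty]
  exact Set.eq_empty_iff_forall_notMem.2 (h w)

end Classes

end FatMotive

namespace FatMotive

variable {k : Type u} [Field k]

/-! ### Existence of classes -/

section Decomposition

variable {X : Over (Base k)}

/-- `B` is a finite disjoint union of differences of formal sieves. -/
def HasDecomposition (B : ∀ w, Set ((splitRes (points X)).obj w)) : Prop :=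
  ∃ (ι : Type) (_ : Fintype ι) (C D : ι → MSieve X), (∀ i, IsFormal (C i)) ∧
    (∀ i, IsFormal (D i)) ∧ (∀ i, D i ≤ C i) ∧
    (∀ w a, a ∈ B w ↔ ∃ i, a ∈ (MSieve.toSplit (C i)).obj w ∧ a ∉ (MSieve.toSplit (D i)).obj w) ∧
    ∀ w a i j, (a ∈ (MSieve.toSplit (C i)).obj w ∧ a ∉ (MSieve.toSplit (D i)).obj w) →
      (a ∈ (MSieve.toSplit (C j)).obj w ∧ a ∉ (MSieve.toSplit (D j)).obj w) → i = j

theorem HasDecomposition.exists_hasClass [IsAlgScheme X] {F : SplitSieve X}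
    (h : HasDecomposition F.obj) : ∃ v, HasClass F v := by
  obtain ⟨ι, _, C, D, hC, hD, hDC, hF, hdis⟩ := h
  let e := (Fintype.equivFin ι).symm
  refine ⟨_, _, C ∘ e, D ∘ e, fun i => hC _, fun i => hD _, fun i => hDC _, fun w => ?_,
    fun w i j hij => ?_, rfl⟩
  · ext a
    rw [hF, Set.mem_iUnion]
    constructor
    · rintro ⟨i, hi⟩
      obtain ⟨i, rfl⟩ := e.surjective i
      exact ⟨i, hi⟩
    · rintro ⟨i, hi⟩
      exact ⟨e i, hi⟩
  · exact Set.disjoint_left.2 fun a ha ha' => hij (e.injective (hdis w a _ _ ha ha'))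

theorem hasDecomposition_sdiff {C D : MSieve X} (hC : IsFormal C) (hD : IsFormal D)
    (h : D ≤ C) : HasDecomposition ((MSieve.toSplit C).obj \ (MSieve.toSplit D).obj) :=
  ⟨Unit, inferInstance, fun _ => C, fun _ => D, fun _ => hC, fun _ => hD, fun _ => h,
    fun _ _ => ⟨fun ha => ⟨(), ha⟩, fun ⟨_, ha⟩ => ha⟩, fun _ _ _ _ _ _ => rfl⟩

variable [IsAlgScheme X]

theorem hasDecomposition_top :
    HasDecomposition (⊤ : ∀ w, Set ((splitRes (points X)).obj w)) := by
  have h := hasDecomposition_sdiff (X := X) isFormal_top isFormal_bot bot_le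
  convert h using 1
  ext w a
  exact ⟨fun _ => ⟨trivial, id⟩, fun _ => trivial⟩

/-- `(C \ D) ∩ (C' \ D') = (C ∩ C') \ ((D ∩ C') ∪ (C ∩ D'))`, and the pieces for distinct pairs of
indices stay disjoint. -/
theorem HasDecomposition.inf {B B' : ∀ w, Set ((splitRes (points X)).obj w)}
    (h : HasDecomposition B) (h' : HasDecomposition B') : HasDecomposition (B ⊓ B') := by
  obtain ⟨ι, _, C, D, hC, hD, hDC, hB, hdis⟩ := h
  obtain ⟨ι', _, C', D', hC', hD', hDC', hB', hdis'⟩ := h'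
  have key : ∀ w a (i : ι) (j : ι'), (a ∈ (MSieve.toSplit (C i ⊓ C' j)).obj w ∧
      a ∉ (MSieve.toSplit ((D i ⊓ C' j) ⊔ (C i ⊓ D' j))).obj w) ↔
      (a ∈ (MSieve.toSplit (C i)).obj w ∧ a ∉ (MSieve.toSplit (D i)).obj w) ∧
      (a ∈ (MSieve.toSplit (C' j)).obj w ∧ a ∉ (MSieve.toSplit (D' j)).obj w) := by
    intro w a i j
    change ((a ∈ (MSieve.toSplit (C i)).obj w ∧ a ∈ (MSieve.toSplit (C' j)).obj w) ∧
      ¬ ((a ∈ (MSieve.toSplit (D i)).obj w ∧ a ∈ (MSieve.toSplit (C' j)).obj w) ∨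
        (a ∈ (MSieve.toSplit (C i)).obj w ∧ a ∈ (MSieve.toSplit (D' j)).obj w))) ↔ _
    tauto
  refine ⟨ι × ι', inferInstance, fun p => C p.1 ⊓ C' p.2,
    fun p => (D p.1 ⊓ C' p.2) ⊔ (C p.1 ⊓ D' p.2), fun p => (hC _).inf (hC' _),
    fun p => ((hD _).inf (hC' _)).sup ((hC _).inf (hD' _)),
    fun p => sup_le (inf_le_inf_right _ (hDC _)) (inf_le_inf_left _ (hDC' _)), ?_, ?_⟩
  · intro w a
    refine (and_congr (hB w a) (hB' w a)).trans ⟨?_, ?_⟩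
    · rintro ⟨⟨i, hi⟩, ⟨j, hj⟩⟩
      exact ⟨(i, j), (key w a i j).2 ⟨hi, hj⟩⟩
    · rintro ⟨⟨i, j⟩, h⟩
      exact ⟨⟨i, ((key w a i j).1 h).1⟩, ⟨j, ((key w a i j).1 h).2⟩⟩
  · rintro w a ⟨i, j⟩ ⟨i', j'⟩ h h'
    have h := (key w a i j).1 h
    have h' := (key w a i' j').1 h'
    exact Prod.ext (hdis w a _ _ h.1 h'.1) (hdis' w a _ _ h.2 h'.2)

/-- Since `D ⊆ C`, the complement of `C \ D` is the disjoint union of `⊤ \ C` (index `true`) and `D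
\ ⊥` (index `false`). -/
theorem hasDecomposition_compl_sdiff {C D : MSieve X} (hC : IsFormal C) (hD : IsFormal D)
    (h : D ≤ C) : HasDecomposition ((MSieve.toSplit C).obj \ (MSieve.toSplit D).obj)ᶜ := by
  have hle : ∀ w a, a ∈ (MSieve.toSplit D).obj w → a ∈ (MSieve.toSplit C).obj w :=
    fun w a ha => h _ ha
  refine ⟨Bool, inferInstance, fun b => cond b ⊤ D, fun b => cond b C ⊥,
    fun b => by cases b; exacts [hD, isFormal_top], fun b => by cases b; exacts [isFormal_bot, hC],
    fun b => by cases b; exacts [bot_le, le_top], fun w a => ?_, fun w a i j => ?_⟩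
  · change ¬ (a ∈ (MSieve.toSplit C).obj w ∧ a ∉ (MSieve.toSplit D).obj w) ↔ _
    have := hle w a
    rw [Bool.exists_bool]
    change _ ↔ (a ∈ (MSieve.toSplit D).obj w ∧ ¬ False) ∨ (True ∧ a ∉ (MSieve.toSplit C).obj w)
    tauto
  · have := hle w a
    rcases i with _ | _ <;> rcases j with _ | _ <;> intro h₁ h₂
    · rfl
    · exact (h₂.2 (this h₁.1)).elim
    · exact (h₁.2 (this h₂.1)).elim
    · rfl

theorem HasDecomposition.compl {B : ∀ w, Set ((splitRes (points X)).obj w)}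
    (h : HasDecomposition B) : HasDecomposition Bᶜ := by
  obtain ⟨ι, _, C, D, hC, hD, hDC, hB, -⟩ := h
  have e : Bᶜ = Finset.univ.inf fun i =>
      ((MSieve.toSplit (C i)).obj \ (MSieve.toSplit (D i)).obj)ᶜ := by
    ext w a
    rw [Finset.inf_univ_eq_iInf, iInf_apply]
    change ¬ _ ↔ a ∈ ⨅ i, _
    rw [hB, not_exists, Set.iInf_eq_iInter, Set.mem_iInter]
    exact Iff.rfl
  rw [e]
  exact Finset.inf_induction hasDecomposition_top (fun _ h _ h' => h.inf h')
    fun i _ => hasDecomposition_compl_sdiff (hC i) (hD i) (hDC i)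

/-- The decomposable families form a Boolean subalgebra containing the formal sieves. They are
families of sets rather than subfunctors, so that complements are available. -/
theorem IsSplitFormal.hasDecomposition {F : SplitSieve X} (h : IsSplitFormal F) :
    HasDecomposition F.obj := by
  let S : BooleanSubalgebra (∀ w, Set ((splitRes (points X)).obj w)) :=
    { carrier := {B | HasDecomposition B}
      supClosed' := fun A hA B hB => by
        have := (HasDecomposition.inf (HasDecomposition.compl hA)
          (HasDecomposition.compl hB)).compl
        rwa [compl_inf, compl_compl, compl_compl] at this
      infClosed' := fun A hA B hB => HasDecomposition.inf hA hB
      compl_mem' := fun hA => HasDecomposition.compl hA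
      bot_mem' := by
        have := (hasDecomposition_top (X := X)).compl
        rwa [compl_top] at this }
  have hS : BooleanSubalgebra.closure
      {B | ∃ C : MSieve X, IsFormal C ∧ B = (MSieve.toSplit C).obj} ≤ S := by
    rw [BooleanSubalgebra.closure_le]
    rintro _ ⟨C, hC, rfl⟩
    have e : (MSieve.toSplit C).obj =
        (MSieve.toSplit C).obj \ (MSieve.toSplit (⊥ : MSieve X)).obj := by
      ext w a
      exact ⟨fun h => ⟨h, id⟩, fun h => h.1⟩
    change HasDecomposition _
    rw [e]
    exact hasDecomposition_sdiff hC isFormal_bot bot_le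
  exact hS h

theorem IsSplitFormal.existsUnique_hasClass {F : SplitSieve X} (h : IsSplitFormal F) :
    ∃! v, HasClass F v := by
  obtain ⟨v, hv⟩ := h.hasDecomposition.exists_hasClass
  exact ⟨v, hv, fun _ hu => hu.unique hv⟩

end Decomposition

/-! ### Restriction of sieves along monomorphisms -/

section Restriction

theorem isFormal_range {V X : Over (Base k)} [IsAlgScheme V] (j : V ⟶ X) :
    IsFormal (Subfunctor.range (pointsMap j)) :=
  IsSubZariski.isFormal ⟨V, inferInstance, j, rfl⟩

variable {V X : Over (Base k)} [IsAlgScheme V] [IsAlgScheme X]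

/-- A morphism `j : V ⟶ X` which is injective on points over fat points and such that every
morphism to `X` whose points over fat points factor through `j` factors through `j`. -/
structure IsPointwiseEmbedding (j : V ⟶ X) : Prop where
  injective : ∀ (w : FatPoint k) (a b : w.obj ⟶ V), a ≫ j = b ≫ j → a = b
  exists_lift : ∀ (W : Over (Base k)) [IsAlgScheme W] (φ : W ⟶ X),
    Subfunctor.range (pointsMap φ) ≤ Subfunctor.range (pointsMap j) → ∃ ψ : W ⟶ V, ψ ≫ j = φ

/-- Injectivity of `j` on points makes the two sieves isomorphic as presheaves. That the inverse is
a morphism of motives is exactly what the lifting condition on `j` provides. -/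
theorem formalClass_preimage {j : V ⟶ X} (hj : IsPointwiseEmbedding j) {C : MSieve X}
    (hC : IsFormal C) : formalClass (C.preimage (pointsMap j)) (hC.preimage j) =
      formalClass (C ⊓ Subfunctor.range (pointsMap j)) (hC.inf (isFormal_range j)) := by
  let f : (C.preimage (pointsMap j)).toFunctor ⟶
      (C ⊓ Subfunctor.range (pointsMap j)).toFunctor :=
    Subfunctor.lift ((C.preimage (pointsMap j)).ι ≫ pointsMap j) (by
      rintro w _ ⟨a, rfl⟩
      exact ⟨a.2, ⟨a.1, rfl⟩⟩)
  have hf : f ≫ (C ⊓ Subfunctor.range (pointsMap j)).ι =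
      (C.preimage (pointsMap j)).ι ≫ pointsMap j := rfl
  have : ∀ w, IsIso (f.app w) := by
    intro w
    rw [isIso_iff_bijective]
    constructor
    · intro a b hab
      exact Subtype.ext (hj.injective w.unop a.1 b.1 (congrArg Subtype.val hab))
    · rintro ⟨_, h, ⟨b, rfl⟩⟩
      exact ⟨⟨b, h⟩, rfl⟩
  have : IsIso f := NatIso.isIso_of_isIso_app f
  have hmono : ∀ {F : (FatPoint k)ᵒᵖ ⥤ Type u} (s t : F ⟶ points V),
      s ≫ pointsMap j = t ≫ pointsMap j → s = t := by
    intro F s t hst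
    ext w a
    exact hj.injective w.unop _ _ (ConcreteCategory.congr_hom (congrArg (NatTrans.app · w) hst) a)
  refine formalClass_iso _ _ (asIso f) (fun W _ φ h => ⟨φ ≫ j, ?_⟩) (fun W _ φ h => ?_)
  · rfl
  · obtain ⟨ψ, rfl⟩ := hj.exists_lift W φ (h.trans inf_le_right)
    refine ⟨ψ, hmono _ _ ?_⟩
    have h₁ : inv f ≫ (C.preimage (pointsMap j)).ι ≫ pointsMap j =
        (C ⊓ Subfunctor.range (pointsMap j)).ι := by rw [← hf, IsIso.inv_hom_id_assoc]
    change (Subfunctor.lift (pointsMap (ψ ≫ j)) h ≫ inv f ≫ (C.preimage (pointsMap j)).ι) ≫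
      pointsMap j = _
    rw [Category.assoc, Category.assoc, h₁]
    rfl

theorem HasClass.exists_pullback {j : V ⟶ X} (hj : IsPointwiseEmbedding j) {F : SplitSieve X}
    {v : LocGrot k} (h : HasClass F v) : ∃ u, HasClass (F.pullback j) u ∧
      HasClass (F ⊓ MSieve.toSplit (Subfunctor.range (pointsMap j))) u := by
  obtain ⟨n, C, D, hC, hD, hDC, hF, hdis, -⟩ := h
  refine ⟨_, ⟨n, fun i => (C i).preimage (pointsMap j), fun i => (D i).preimage (pointsMap j),
    fun i => (hC i).preimage j, fun i => (hD i).preimage j, fun i w a ha => hDC i w ha,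
    fun w => ?_, fun w i i' hii => ?_, rfl⟩,
    ⟨n, fun i => C i ⊓ Subfunctor.range (pointsMap j),
      fun i => D i ⊓ Subfunctor.range (pointsMap j), fun i => (hC i).inf (isFormal_range j),
      fun i => (hD i).inf (isFormal_range j), fun i => inf_le_inf_right _ (hDC i),
      fun w => ?_, fun w i i' hii => ?_, ?_⟩⟩
  · ext a
    have h := Set.ext_iff.1 (hF w) ((Functor.whiskerLeft _ (pointsMap j)).app w a)
    rw [Set.mem_iUnion] at h ⊢
    exact h
  · exact Set.disjoint_left.2 fun a ha ha' => Set.disjoint_left.1 (hdis w hii) ha ha'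
  · ext a
    have h := Set.ext_iff.1 (hF w) a
    rw [Set.mem_iUnion] at h ⊢
    constructor
    · rintro ⟨h₁, h₂⟩
      obtain ⟨i, hi⟩ := h.1 h₁
      exact ⟨i, ⟨hi.1, h₂⟩, fun h' => hi.2 h'.1⟩
    · rintro ⟨i, hi⟩
      exact ⟨h.2 ⟨i, hi.1.1, fun h' => hi.2 ⟨h', hi.1.2⟩⟩, hi.1.2⟩
  · exact Set.disjoint_left.2 fun a ha ha' => Set.disjoint_left.1 (hdis w hii)
      ⟨ha.1.1, fun h => ha.2 ⟨h, ha.1.2⟩⟩ ⟨ha'.1.1, fun h => ha'.2 ⟨h, ha'.1.2⟩⟩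
  · exact Finset.sum_congr rfl fun i _ => by
      rw [formalClass_preimage hj (hC i), formalClass_preimage hj (hD i)]

/-- Classes can be computed after restriction along a pointwise embedding. -/
theorem HasClass.of_pullback {j : V ⟶ X} (hj : IsPointwiseEmbedding j) {F : SplitSieve X}
    {u v : LocGrot k} (h : HasClass F v) (hu : HasClass (F.pullback j) u) :
    HasClass (F ⊓ MSieve.toSplit (Subfunctor.range (pointsMap j))) u := by
  obtain ⟨u', h₁, h₂⟩ := h.exists_pullback hj
  rwa [hu.unique h₁]

end Restriction

end FatMotive

namespace FatMotive

variable {k : Type u} [Field k]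

/-! ### Arc sieves -/

section ArcSieves

theorem isAlgScheme_of_isFatPoint {w : Over (Base k)} (hw : isFatPoint k w) : IsAlgScheme w := by
  have := hw.1
  exact ⟨inferInstance, inferInstance, inferInstance⟩

theorem isFatPoint_unit : isFatPoint k (𝟙_ (Over (Base k))) :=
  ⟨inferInstanceAs (IsFinite (𝟙 (Base k))), ⟨IsLocalRing.closedPoint k⟩,
    inferInstanceAs (Subsingleton (PrimeSpectrum k))⟩

variable {z : FatPoint k} {X Y : Over (Base k)}

/-- The morphism of arc schemes induced by a morphism of schemes. -/
noncomputable def ArcScheme.map (A : ArcScheme z X) (B : ArcScheme z Y) (f : X ⟶ Y) :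
    A.space ⟶ B.space :=
  ((B.bijective A.space).2 (A.ev ≫ f)).choose

theorem ArcScheme.map_ev (A : ArcScheme z X) (B : ArcScheme z Y) (f : X ⟶ Y) :
    (z.obj ◁ A.map B f) ≫ B.ev = A.ev ≫ f :=
  ((B.bijective A.space).2 (A.ev ≫ f)).choose_spec

theorem ArcScheme.whisker_map_ev (A : ArcScheme z X) (B : ArcScheme z Y) (f : X ⟶ Y)
    {T : Over (Base k)} (a : T ⟶ A.space) :
    (z.obj ◁ (a ≫ A.map B f)) ≫ B.ev = ((z.obj ◁ a) ≫ A.ev) ≫ f := by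
  rw [whiskerLeft_comp, Category.assoc, A.map_ev, Category.assoc]

theorem ArcScheme.hom_ext (A : ArcScheme z X) {T : Over (Base k)} [IsAlgScheme T]
    {a b : T ⟶ A.space} (h : (z.obj ◁ a) ≫ A.ev = (z.obj ◁ b) ≫ A.ev) : a = b :=
  (A.bijective T).1 h

theorem ArcScheme.exists_hom (A : ArcScheme z X) {T : Over (Base k)} [IsAlgScheme T]
    (b : z.obj ⊗ T ⟶ X) : ∃ a : T ⟶ A.space, (z.obj ◁ a) ≫ A.ev = b :=
  (A.bijective T).2 b

theorem isPointwiseEmbedding_of_iso {V X : Over (Base k)} (e : V ≅ X) :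
    IsPointwiseEmbedding e.hom where
  injective _ a b h := (cancel_mono e.hom).1 h
  exists_lift W _ φ _ := ⟨φ ≫ e.inv, by simp⟩

/-- Two arc schemes of the same scheme are isomorphic. -/
theorem ArcScheme.exists_iso [IsAlgScheme X] (A B : ArcScheme z X) :
    ∃ e : A.space ≅ B.space, e.hom = A.map B (𝟙 X) := by
  refine ⟨⟨A.map B (𝟙 X), B.map A (𝟙 X), ?_, ?_⟩, rfl⟩
  · apply A.hom_ext
    rw [B.whisker_map_ev, A.map_ev]
    simp
  · apply B.hom_ext
    rw [A.whisker_map_ev, B.map_ev]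
    simp

variable [IsAlgClosed k]

theorem nonempty_arcScheme (z : FatPoint k) (X : Over (Base k)) [IsAlgScheme X] :
    Nonempty (ArcScheme z X) := by
  have := z.property.1
  have := z.property.2.2
  obtain ⟨p, -⟩ := exists_section z.property.1 z.property.2.1.some
  obtain ⟨S, ev, hS, h⟩ := exists_isArc z.obj X p
  exact ⟨⟨S, hS, ev, fun T _ => h T⟩⟩

/-- The arc sieve of a sieve. -/
def ArcScheme.arcSieve (A : ArcScheme z X) (C : MSieve X) : MSieve A.space where
  obj w := {a | (z.obj ◁ (show w.unop.obj ⟶ A.space from a)) ≫ A.ev ∈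
    C.obj (op ((prodLeft z).obj w.unop))}
  map {v w} i a ha := by
    have h := C.map ((prodLeft z).map i.unop).op ha
    have e : (z.obj ◁ (i.unop.hom ≫ (show v.unop.obj ⟶ A.space from a))) ≫ A.ev =
        (z.obj ◁ i.unop.hom) ≫ (z.obj ◁ (show v.unop.obj ⟶ A.space from a)) ≫ A.ev := by
      rw [whiskerLeft_comp, Category.assoc]
    change (z.obj ◁ (i.unop.hom ≫ (show v.unop.obj ⟶ A.space from a))) ≫ A.ev ∈
      C.obj (op ((prodLeft z).obj w.unop))
    rw [e]
    exact h

/-- By the universal property, a lift of `z × w ⟶ X` through `f` is the same as a lift of the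
corresponding `w`-point to the arc scheme of `Y`. -/
theorem ArcScheme.arcSieve_range [IsAlgScheme Y] (A : ArcScheme z X) (B : ArcScheme z Y)
    (f : Y ⟶ X) : A.arcSieve (Subfunctor.range (pointsMap f)) =
      Subfunctor.range (pointsMap (B.map A f)) := by
  ext w a
  change w.unop.obj ⟶ A.space at a
  have : IsAlgScheme w.unop.obj := isAlgScheme_of_isFatPoint w.unop.property
  constructor
  · rintro ⟨b, hb⟩
    change z.obj ⊗ w.unop.obj ⟶ Y at b
    have hb : b ≫ f = (z.obj ◁ a) ≫ A.ev := hb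
    obtain ⟨c, rfl⟩ := B.exists_hom (T := w.unop.obj) b
    refine ⟨c, ?_⟩
    change c ≫ B.map A f = a
    apply A.hom_ext
    rw [B.whisker_map_ev, hb]
  · rintro ⟨c, hc⟩
    change w.unop.obj ⟶ B.space at c
    have hc : c ≫ B.map A f = a := hc
    subst hc
    exact ⟨(z.obj ◁ c) ≫ B.ev, (B.whisker_map_ev A f c).symm⟩

/-- To approximate the arc sieve at `w`, approximate `C` at `z × w` and take arcs; the arcs of an
image form an image again. -/
theorem IsFormal.arcSieve [IsAlgScheme X] (A : ArcScheme z X) {C : MSieve X} (h : IsFormal C) :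
    IsFormal (A.arcSieve C) := by
  intro w
  obtain ⟨N, hle, ⟨Y, hY, f, rfl⟩, hN⟩ := h ((prodLeft z).obj w)
  obtain ⟨B⟩ := nonempty_arcScheme z Y
  refine ⟨A.arcSieve (Subfunctor.range (pointsMap f)), fun v a ha => hle _ ha,
    ⟨B.space, B.isAlg, _, A.arcSieve_range B f⟩, ?_⟩
  ext a
  exact Set.ext_iff.1 hN _

theorem IsSplitFormal.arc [IsAlgScheme X] (A : ArcScheme z X) {F : SplitSieve X}
    (h : IsSplitFormal F) : IsSplitFormal (A.arc F) := by
  let φ : BoundedLatticeHom (∀ w, Set ((splitRes (points X)).obj w))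
      (∀ w, Set ((splitRes (points A.space)).obj w)) :=
    { toFun := fun B w => A.toPoint w ⁻¹' B _
      map_sup' := fun _ _ => rfl
      map_inf' := fun _ _ => rfl
      map_top' := rfl
      map_bot' := rfl }
  have key : BooleanSubalgebra.closure
        {B | ∃ C : MSieve X, IsFormal C ∧ B = (MSieve.toSplit C).obj} ≤
      (BooleanSubalgebra.closure
        {B | ∃ C : MSieve A.space, IsFormal C ∧ B = (MSieve.toSplit C).obj}).comap φ := by
    rw [BooleanSubalgebra.closure_le]
    rintro _ ⟨C, hC, rfl⟩
    exact BooleanSubalgebra.subset_closure ⟨A.arcSieve C, hC.arcSieve A, rfl⟩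
  exact key h

theorem ArcScheme.arc_pullback (A : ArcScheme z X) (B : ArcScheme z Y) (f : X ⟶ Y)
    (F : SplitSieve Y) : A.arc (F.pullback f) = (B.arc F).pullback (A.map B f) := by
  ext w a
  change w.unop.obj.obj ⟶ A.space at a
  change ((z.obj ◁ a) ≫ A.ev) ≫ f ∈ F.obj ((splitProdLeft z).op.obj w) ↔
    (z.obj ◁ (a ≫ A.map B f)) ≫ B.ev ∈ F.obj ((splitProdLeft z).op.obj w)
  rw [A.whisker_map_ev]

/-! ### Arc schemes of open subschemes -/

/-- Every closed point of a `k`-scheme is the image of a section. -/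
theorem exists_section_of_isClosed {T : Over (Base k)} [IsAlgScheme T] (x : T.left)
    (hx : IsClosed ({x} : Set T.left)) :
    ∃ q : 𝟙_ (Over (Base k)) ⟶ T, q.left (IsLocalRing.closedPoint k) = x :=
  ⟨Over.homMk (pointOfClosedPoint T.hom x hx) (by rw [pointOfClosedPoint_comp]; rfl),
    pointOfClosedPoint_apply T.hom x hx _⟩

/-- The complement of the inverse image of `U`, if non-empty, contains a closed point because `T` is
Jacobson, and closed points are rational over an algebraically closed field. -/
theorem forall_mem_of_section {T X : Over (Base k)} [IsAlgScheme T] (b : T ⟶ X)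
    (U : X.left.Opens) (h : ∀ q : 𝟙_ (Over (Base k)) ⟶ T,
      (q ≫ b).left (IsLocalRing.closedPoint k) ∈ U) (t : T.left) : b.left t ∈ U := by
  have : JacobsonSpace T.left := LocallyOfFiniteType.jacobsonSpace T.hom
  by_contra ht
  have hcl : IsClosed ((b.left ⁻¹ᵁ U : T.left.Opens) : Set T.left)ᶜ :=
    (b.left ⁻¹ᵁ U).isOpen.isClosed_compl
  have hne : (((b.left ⁻¹ᵁ U : T.left.Opens) : Set T.left)ᶜ ∩ closedPoints T.left).Nonempty := by
    rw [← closure_nonempty_iff, JacobsonSpace.closure_inter_closedPoints hcl]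
    exact ⟨t, ht⟩
  obtain ⟨x, hx, hx'⟩ := hne
  obtain ⟨q, rfl⟩ := exists_section_of_isClosed x hx'
  exact hx (h q)

theorem ArcScheme.isPointwiseEmbedding_openSub [IsAlgScheme X] {U : X.left.Opens}
    (B : ArcScheme z (openSub X U)) (A : ArcScheme z X) :
    IsPointwiseEmbedding (B.map A (openSub.ι X U)) := by
  have hinj : ∀ (T : Over (Base k)) [IsAlgScheme T] (a b : T ⟶ B.space),
      a ≫ B.map A (openSub.ι X U) = b ≫ B.map A (openSub.ι X U) → a = b := by
    intro T _ a b h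
    apply B.hom_ext
    rw [← cancel_mono (openSub.ι X U), ← B.whisker_map_ev A, ← B.whisker_map_ev A, h]
  refine ⟨fun w a b h => ?_, fun W _ φ h => ?_⟩
  · have := isAlgScheme_of_isFatPoint w.property
    exact hinj _ a b h
  · have := isAlgScheme_of_isFatPoint z.property
    -- It suffices to test rational points `q` of `z × W`. The hypothesis at the trivial fat point
    -- says that the arc defined by the `W`-component of `q` lies in `U`, and `q` maps to a point of
    -- that arc.
    obtain ⟨d, hd⟩ := exists_lift_openSub U ((z.obj ◁ φ) ≫ A.ev) (forall_mem_of_section _ U (by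
      intro q
      obtain ⟨b, hb⟩ := h (op ⟨𝟙_ _, isFatPoint_unit⟩) ⟨q ≫ snd _ _, rfl⟩
      change 𝟙_ _ ⟶ B.space at b
      have hb : b ≫ B.map A (openSub.ι X U) = (q ≫ snd _ _) ≫ φ := hb
      have hq : q ≫ (z.obj ◁ φ) = lift (q ≫ fst _ _) (𝟙 _) ≫
          (z.obj ◁ ((q ≫ snd _ _) ≫ φ)) := by
        apply CartesianMonoidalCategory.hom_ext <;> simp
      have hq' : q ≫ (z.obj ◁ φ) ≫ A.ev =
          (lift (q ≫ fst _ _) (𝟙 _) ≫ (z.obj ◁ b) ≫ B.ev) ≫ openSub.ι X U := by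
        rw [← Category.assoc, hq, ← hb, Category.assoc, B.whisker_map_ev]
        simp only [Category.assoc]
      rw [hq']
      exact openSub.ι_apply_mem U _ _))
    obtain ⟨ψ, rfl⟩ := B.exists_hom d
    refine ⟨ψ, A.hom_ext ?_⟩
    rw [B.whisker_map_ev, hd]

/-- As `z × w` has a single point `t`, membership in the arcs of `U` is decided by the image of `t`
alone. -/
theorem ArcScheme.mem_range_openSub [IsAlgScheme X] (U : X.left.Opens)
    (A : ArcScheme z X) (B : ArcScheme z (openSub X U)) (w : FatPoint k) (a : w.obj ⟶ A.space)
    (t : (z.obj ⊗ w.obj).left) :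
    (show (points A.space).obj (op w) from a) ∈
      (Subfunctor.range (pointsMap (B.map A (openSub.ι X U)))).obj (op w) ↔
    ((z.obj ◁ a) ≫ A.ev).left t ∈ U := by
  have := isAlgScheme_of_isFatPoint w.property
  rw [mem_range_pointsMap]
  constructor
  · rintro ⟨b, rfl⟩
    rw [B.whisker_map_ev]
    exact openSub.ι_apply_mem U _ t
  · intro h
    have := (isFatPoint_tensor z.property w.property).2.2
    obtain ⟨d, hd⟩ := exists_lift_openSub U ((z.obj ◁ a) ≫ A.ev) fun t' => by
      rwa [Subsingleton.elim t' t]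
    obtain ⟨b, rfl⟩ := B.exists_hom d
    exact ⟨b, A.hom_ext (by rw [B.whisker_map_ev, hd])⟩

theorem HasClass.arc_unique [IsAlgScheme X] (A B : ArcScheme z X) {F : SplitSieve X}
    {u v : LocGrot k} (hu : HasClass (A.arc F) u) (hv : HasClass (B.arc F) v) : u = v := by
  obtain ⟨e, he⟩ := A.exists_iso B
  have h : A.arc F = (B.arc F).pullback e.hom := by
    rw [he, ← A.arc_pullback B]
    have hF : F.pullback (𝟙 X) = F := by
      ext w a
      change (show w.unop.obj.obj ⟶ X from a) ≫ 𝟙 X ∈ F.obj w ↔ a ∈ F.obj w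
      rw [Category.comp_id]
      exact Iff.rfl
    rw [hF]
  rw [h] at hu
  have h' := HasClass.of_pullback (isPointwiseEmbedding_of_iso e) hv hu
  have h'' : B.arc F ⊓ MSieve.toSplit (Subfunctor.range (pointsMap e.hom)) = B.arc F := by
    refine inf_eq_left.2 fun w a _ => ⟨(show w.unop.obj.obj ⟶ B.space from a) ≫ e.inv, ?_⟩
    exact (Category.assoc _ _ _).trans ((congrArg _ e.inv_hom_id).trans (Category.comp_id _))
  rw [h''] at h'
  exact h'.unique hv

end ArcSieves

/-! ### Integrals -/

section Integrals

theorem mem_biInf_opens {T : Type*} [TopologicalSpace T] {ι : Type*} (I : Finset ι)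
    (U : ι → TopologicalSpace.Opens T) (x : T) : x ∈ ⨅ i ∈ I, U i ↔ ∀ i ∈ I, x ∈ U i := by
  rw [← Finset.inf_eq_iInf, ← SetLike.mem_coe, TopologicalSpace.Opens.coe_finset_inf]
  simp

theorem sum_neg_one_pow_card_subset {ι : Type*} [Fintype ι] [DecidableEq ι] {S : Finset ι}
    (hS : S.Nonempty) : ∑ I : Finset ι, (-1 : ℤ) ^ I.card * (if I ⊆ S then 1 else 0) = 0 := by
  simp only [mul_ite, mul_one, mul_zero]
  rw [← Finset.sum_filter, ← Finset.sum_powerset_neg_one_pow_card_of_nonempty hS]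
  congr 1
  ext I
  simp

/-- The place where equidimensionality enters: it equates the exponents of the Lefschetz class. -/
theorem dim_openSub {X : Over (Base k)} (hX : IsEquidimensional X.left) {U : X.left.Opens}
    (hU : (U : Set X.left).Nonempty) : dim (openSub X U).left = dim X.left :=
  congrArg (fun d => (WithBot.unbotD 0 d).toNat) (hX U hU)

variable [IsAlgClosed k] {X : Over (Base k)} [IsAlgScheme X] {M : SplitSieve X} {z : FatPoint k}

/-- The motivic integral exists and does not depend on the choice of the arc scheme. -/
theorem existsUnique_isMotivicIntegral (z : FatPoint k) (s : FormalInvariant M) :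
    ∃! v, IsMotivicIntegral z s v := by
  obtain ⟨A⟩ := nonempty_arcScheme z X
  choose c hc using fun g => ((s.fibre_splitFormal g).arc A).existsUnique_hasClass.exists
  refine ⟨_, ⟨A, c, hc, rfl⟩, ?_⟩
  rintro _ ⟨B, d, hd, rfl⟩
  have : d = c := funext fun g => (hd g).arc_unique B A (hc g)
  rw [this]

theorem motivicIntegral_eq {s : FormalInvariant M} {v : LocGrot k}
    (h : IsMotivicIntegral z s v) : motivicIntegral z s = v := by
  have hex : ∃ v, IsMotivicIntegral z s v := ⟨v, h⟩
  rw [motivicIntegral, dif_pos hex]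
  exact (existsUnique_isMotivicIntegral z s).unique hex.choose_spec h

theorem hasClass_arc_eq_zero {X : Over (Base k)} {M : SplitSieve X} (A : ArcScheme z X)
    {s : FormalInvariant M} {g v : LocGrot k} (hg : g ∉ s.finite_fibres.toFinset)
    (h : HasClass (A.arc (s.fibre g)) v) : v = 0 :=
  h.unique (hasClass_zero fun _ _ ha => hg (s.finite_fibres.mem_toFinset.2 ⟨_, _, ha⟩))

/-- Empty fibres have class zero, so the sum may run over any larger finite set. This allows one
index set for `s` and all its restrictions. -/
theorem motivicIntegral_eq_sum (A : ArcScheme z X) {s : FormalInvariant M}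
    {c : LocGrot k → LocGrot k} (hc : ∀ g, HasClass (A.arc (s.fibre g)) (c g))
    {S : Finset (LocGrot k)} (hS : s.finite_fibres.toFinset ⊆ S) :
    motivicIntegral z s =
      IsLocalization.Away.invSelf (lefschetz k) ^ (dim X.left * z.length) * ∑ g ∈ S, g * c g := by
  rw [motivicIntegral_eq ⟨A, c, hc, rfl⟩]
  congr 1
  exact Finset.sum_subset hS fun g _ hg => by rw [hasClass_arc_eq_zero A hg (hc g), mul_zero]

/-! ### Inclusion-exclusion -/

theorem hasClass_arc_inclusion_exclusion {ι : Type} [Fintype ι] {U : ι → X.left.Opens}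
    (hU : ⨆ i, U i = ⊤) (A : ArcScheme z X)
    (B : ∀ I : Finset ι, ArcScheme z (openSub X (⨅ i ∈ I, U i))) (F : SplitSieve X)
    {v : LocGrot k} {c : Finset ι → LocGrot k} (hv : HasClass (A.arc F) v)
    (hc : ∀ I, HasClass ((B I).arc (F.pullback (openSub.ι X _))) (c I)) :
    v = ∑ I : Finset ι with I.Nonempty, (-1) ^ (I.card + 1) * c I := by
  classical
  let R : Finset ι → SplitSieve A.space := fun I =>
    A.arc F ⊓ MSieve.toSplit (Subfunctor.range (pointsMap ((B I).map A (openSub.ι X _))))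
  have hR : ∀ I, HasClass (R I) (c I) := fun I => by
    have h := hc I
    rw [(B I).arc_pullback A] at h
    exact hv.of_pullback ((B I).isPointwiseEmbedding_openSub A) h
  have hmem : ∀ (w : (SplitPoint k)ᵒᵖ) (a : (splitRes (points A.space)).obj w),
      ∃ S : Finset ι, S.Nonempty ∧ ∀ I, a ∈ (R I).obj w ↔ a ∈ (A.arc F).obj w ∧ I ⊆ S := by
    intro w a
    change w.unop.obj.obj ⟶ A.space at a
    obtain ⟨t⟩ := (isFatPoint_tensor z.property w.unop.obj.property).2.1
    -- `S` collects the indices of the opens that contain the one point hit by the arc.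
    refine ⟨Finset.univ.filter fun i => ((z.obj ◁ a) ≫ A.ev).left t ∈ U i, ?_,
      fun I => and_congr_right fun _ => ?_⟩
    · have : ((z.obj ◁ a) ≫ A.ev).left t ∈ ⨆ i, U i := hU ▸ trivial
      obtain ⟨i, hi⟩ := TopologicalSpace.Opens.mem_iSup.1 this
      exact ⟨i, Finset.mem_filter.2 ⟨Finset.mem_univ i, hi⟩⟩
    · refine (A.mem_range_openSub _ (B I) w.unop.obj a t).trans ?_
      rw [mem_biInf_opens]
      simp only [Finset.subset_iff, Finset.mem_filter, Finset.mem_univ, true_and]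
  -- The empty intersection is all of `X`, so the term at `∅` of the alternating sum is the class
  -- `v` itself.
  have h₀ : v = c ∅ := by
    have : R ∅ = A.arc F := by
      ext w a
      obtain ⟨S, -, hS⟩ := hmem w a
      simpa using hS ∅
    exact hv.unique (this ▸ hR ∅)
  have key := sum_smul_eq_zero_of_hasClass Finset.univ (fun I => (-1) ^ I.card) R c hR
    (fun w a => by
      obtain ⟨S, hS, h⟩ := hmem w a
      by_cases ha : a ∈ (A.arc F).obj w
      · simp only [h, ha, true_and]
        exact sum_neg_one_pow_card_subset hS
      · simp only [h, ha, false_and, if_false, mul_zero, Finset.sum_const_zero])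
  have hsplit : ({I : Finset ι | I.Nonempty} : Finset (Finset ι)) = Finset.univ.erase ∅ := by
    ext I
    simp [Finset.nonempty_iff_ne_empty]
  rw [← Finset.add_sum_erase _ _ (Finset.mem_univ ∅), ← hsplit] at key
  rw [h₀, ← sub_eq_zero, ← key, sub_eq_add_neg, ← Finset.sum_neg_distrib]
  simp [pow_succ]

theorem hasClass_arc_of_isEmpty {X : Over (Base k)} {U : X.left.Opens}
    (hU : ¬ (U : Set X.left).Nonempty)
    (B : ArcScheme z (openSub X U)) {F : SplitSieve (openSub X U)} {v : LocGrot k}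
    (h : HasClass (B.arc F) v) : v = 0 := by
  refine h.unique (hasClass_zero fun w a _ => ?_)
  change w.unop.obj.obj ⟶ B.space at a
  obtain ⟨t⟩ := (isFatPoint_tensor z.property w.unop.obj.property).2.1
  exact hU ⟨_, (((z.obj ◁ a) ≫ B.ev).left t).2⟩

theorem motivicIntegral_restrict_eq_sum (hX : IsEquidimensional X.left) (U : X.left.Opens)
    (B : ArcScheme z (openSub X U)) (s : FormalInvariant M) {c : LocGrot k → LocGrot k}
    (hc : ∀ g, HasClass (B.arc ((s.fibre g).pullback (openSub.ι X U))) (c g)) :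
    motivicIntegral z (s.restrict U) =
      IsLocalization.Away.invSelf (lefschetz k) ^ (dim X.left * z.length) *
        ∑ g ∈ s.finite_fibres.toFinset, g * c g := by
  have hS : (s.restrict U).finite_fibres.toFinset ⊆ s.finite_fibres.toFinset := by
    intro g hg
    obtain ⟨w, a, h⟩ := (Set.Finite.mem_toFinset _).1 hg
    exact (Set.Finite.mem_toFinset _).2 ⟨w, _, h⟩
  rw [motivicIntegral_eq_sum (s := s.restrict U) B hc hS]
  -- The empty scheme has dimension zero by convention, so the powers of the Lefschetz class may
  -- differ when `U` is empty; but then all classes vanish.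
  by_cases hU : (U : Set X.left).Nonempty
  · rw [dim_openSub hX hU]
  · simp [fun g => hasClass_arc_of_isEmpty hU B (hc g)]

/-- The motivic integral of a formal invariant satisfies inclusion-exclusion for open coverings. -/
theorem motivicIntegral_inclusion_exclusion (hX : IsEquidimensional X.left)
    (s : FormalInvariant M) {ι : Type} [Fintype ι] {U : ι → X.left.Opens} (hU : ⨆ i, U i = ⊤) :
    motivicIntegral z s = ∑ I : Finset ι with I.Nonempty,
      (-1) ^ (I.card + 1) * motivicIntegral z (s.restrict (⨅ i ∈ I, U i)) := by
  obtain ⟨A⟩ := nonempty_arcScheme z X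
  let B : ∀ I : Finset ι, ArcScheme z (openSub X (⨅ i ∈ I, U i)) := fun I =>
    (nonempty_arcScheme z _).some
  choose c hc using fun g => ((s.fibre_splitFormal g).arc A).existsUnique_hasClass.exists
  choose d hd using fun (I : Finset ι) g => (((s.fibre_splitFormal g).pullback
    (openSub.ι X (⨅ i ∈ I, U i))).arc (B I)).existsUnique_hasClass.exists
  rw [motivicIntegral_eq_sum A hc subset_rfl,
    Finset.sum_congr rfl fun I _ => congrArg ((-1) ^ (I.card + 1) * ·)
      (motivicIntegral_restrict_eq_sum hX _ (B I) s (hd I)),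
    Finset.sum_congr rfl fun g _ => congrArg (g * ·)
      (hasClass_arc_inclusion_exclusion hU A B (s.fibre g) (hc g) fun I => hd I g)]
  simp only [Finset.mul_sum]
  rw [Finset.sum_comm]
  exact Finset.sum_congr rfl fun I _ => Finset.sum_congr rfl fun g _ => by ring

end Integrals

end FatMotive

open FatMotive
theorem theoremT {k : Type u} [Field k] [IsAlgClosed k] (X : Over (Base k)) [IsAlgScheme X]
    (hX : IsEquidimensional X.left) (M : SplitSieve X) (s : FormalInvariant M) (z : FatPoint k)
    (n : ℕ) (U : Fin n → X.left.Opens) (hU : ⨆ i, U i = ⊤) :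
    (∃! v, IsMotivicIntegral z s v) ∧
    (∀ I : Finset (Fin n), I.Nonempty →
      ∃! v, IsMotivicIntegral z (s.restrict (⨅ i ∈ I, U i)) v) ∧
    motivicIntegral z s =
      ∑ I : Finset (Fin n) with I.Nonempty,
        (-1) ^ (I.card + 1) * motivicIntegral z (s.restrict (⨅ i ∈ I, U i)) := by
  exact ⟨existsUnique_isMotivicIntegral z s, fun I _ => existsUnique_isMotivicIntegral z _,
    motivicIntegral_inclusion_exclusion hX s hU⟩
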